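/- Let $d\ge 0$ be an integer. A point process on $\mathbb R^d$ is a random measure $X$ on $\mathbb R^d$ with $X(B)\in\mathbb N$ for every bounded measurable $B$. A point process $X$ on $\mathbb R^d$ is called a Hermitian determinantal point process if $X(\{x\})\le 1$ for all $x\in\mathbb R^d$ almost surely and there is a measurable function $K:\mathbb R^d\times\mathbb R^d\to\mathbb C$ with $K(x,y)=\overline{K(y,x)}$ for all $x,y$ such that, for every $k$ and all pairwise disjoint measurable sets $B_1,\dots,B_k\subset\mathbb R^d$, $$\mathbb E[X(B_1)\cdots X(B_k)]=\int_{B_1\times\cdots\times B_k}\det\big(K(x_i,x_j)\big)_{1\le i,j\le k}\,\mathrm dx_1\cdots\mathrm dx_k ,$$ where both sides are elements of $[0,\infty]$ and the determinants are nonnegative almost everywhere. (1) For every real $p\ge1$ there is a constant $\gamma_p>0$, depending only on $p$, such that, for every $d$, every Hermitian determinantal point process $X$ on $\mathbb R^d$ and every measurable set $B\subset\mathbb R^d$ with $\mathbb E[X(B)]<\infty$, the random variable $X(B)$ has finite variance and finite $p$-th moment, and $$\mathbb E\big[|X(B)-\mathbb E[X(B)]|^p\big]\le\gamma_p\big(\operatorname{Var}(X(B))^{p/2}+1\big).$$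 (2) For $p\ge 1$ and $\varepsilon\in(0,1)$, say that a point process $X$ on $\mathbb R^2$ satisfies $\mathrm{H}(p,\varepsilon)$ if there is $\gamma>0$ such that, for every square $B\subset\mathbb R^2$ of area $|B|\ge1$, $X(B)$ has a finite $p$-th moment and $$\mathbb E\big[|X(B)-\mathbb E[X(B)]|^p\big]\le\gamma\,|B|^{(1-\varepsilon)p/2}.$$ If $X$ is a Hermitian determinantal point process on $\mathbb R^2$ that satisfies $\mathrm{H}(2,\varepsilon)$ for some $\varepsilon\in(0,1)$, then $X$ satisfies $\mathrm{H}(p,\varepsilon)$ for every $p\in[1,\infty)$, with the same $\varepsilon$. -/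

import Mathlib

open MeasureTheory ProbabilityTheory

universe u

/-- The number of points `X(B)` as a real random variable. -/
noncomputable def pointCount {Ω : Type*} {d : ℕ}
    (X : Ω → Measure (EuclideanSpace ℝ (Fin d))) (B : Set (EuclideanSpace ℝ (Fin d))) (ω : Ω) : ℝ :=
  (X ω B).toReal

/-- A point process on `ℝ^d`: a random element of the space of point configurations, that is, of
the measures `X` on `ℝ^d` with `X(B) ∈ ℕ` (in particular finite) for every bounded measurable `B`.
The σ-algebra on measures is the one generated by the evaluations `X ↦ X(B)`. -/
structure IsPointProcess {Ω : Type*} [MeasurableSpace Ω] {d : ℕ}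
    (X : Ω → Measure (EuclideanSpace ℝ (Fin d))) : Prop where
  measurable : Measurable X
  integer_valued : ∀ ω, ∀ B : Set (EuclideanSpace ℝ (Fin d)),
    Bornology.IsBounded B → MeasurableSet B → ∃ n : ℕ, X ω B = n

/-- The determinant `det (K(x_i, x_j))_{i,j}`. It is a real number when `K` is Hermitian, which is
why its real part is taken. -/
noncomputable def correlationDet {d : ℕ}
    (K : EuclideanSpace ℝ (Fin d) → EuclideanSpace ℝ (Fin d) → ℂ) {k : ℕ}
    (x : Fin k → EuclideanSpace ℝ (Fin d)) : ℝ :=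
  (Matrix.det (Matrix.of fun i j => K (x i) (x j))).re

/-- `X` is a determinantal point process on `ℝ^d` (with respect to Lebesgue measure) with the
measurable Hermitian kernel `K`. Expectations and integrals are taken in `[0, ∞]`;
`correlationDet_nonneg` makes the right-hand side of `joint_intensity` the genuine integral of the
determinant (it is forced by the identity for disjoint sets). -/
structure IsDeterminantalWithKernel {Ω : Type*} [MeasurableSpace Ω] {d : ℕ} (P : Measure Ω)
    (X : Ω → Measure (EuclideanSpace ℝ (Fin d)))
    (K : EuclideanSpace ℝ (Fin d) → EuclideanSpace ℝ (Fin d) → ℂ) : Prop where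
  isPointProcess : IsPointProcess X
  measurable_kernel : Measurable (Function.uncurry K)
  hermitian : ∀ x y, K x y = starRingEnd ℂ (K y x)
  simple : ∀ᵐ ω ∂P, ∀ x, X ω {x} ≤ 1
  correlationDet_nonneg : ∀ k : ℕ,
    ∀ᵐ x : Fin k → EuclideanSpace ℝ (Fin d), 0 ≤ correlationDet K x
  joint_intensity : ∀ (k : ℕ) (B : Fin k → Set (EuclideanSpace ℝ (Fin d))),
    (∀ i, MeasurableSet (B i)) → Pairwise (fun i j => Disjoint (B i) (B j)) →
    ∫⁻ ω, ∏ i, X ω (B i) ∂P =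
      ∫⁻ x in Set.univ.pi B, ENNReal.ofReal (correlationDet K x)

/-- `X` is a Hermitian determinantal point process on `ℝ^d`. -/
def IsHermitianDPP {Ω : Type*} [MeasurableSpace Ω] {d : ℕ} (P : Measure Ω)
    (X : Ω → Measure (EuclideanSpace ℝ (Fin d))) : Prop :=
  ∃ K, IsDeterminantalWithKernel P X K

/-- `B` is a closed nondegenerate square of the plane, with any position and orientation. -/
def IsPlaneSquare (B : Set (EuclideanSpace ℝ (Fin 2))) : Prop :=
  ∃ s : ℝ, 0 < s ∧ ∃ f : EuclideanSpace ℝ (Fin 2) ≃ᵃⁱ[ℝ] EuclideanSpace ℝ (Fin 2),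
    B = f '' {x | ∀ i, 0 ≤ x i ∧ x i ≤ s}

/-- The `p`-th moment hypothesis with exponent `ε`: for some `γ > 0`, every square `B` of area at
least `1` satisfies `E|X(B) - E X(B)|^p ≤ γ |B|^((1-ε)p/2)`; here `X(B)` is required to have a
finite `p`-th moment, so that both expectations are meaningful and finite. -/
def SquareMomentHypothesis {Ω : Type*} [MeasurableSpace Ω] (P : Measure Ω)
    (X : Ω → Measure (EuclideanSpace ℝ (Fin 2))) (p ε : ℝ) : Prop :=
  ∃ γ : ℝ, 0 < γ ∧ ∀ B : Set (EuclideanSpace ℝ (Fin 2)), IsPlaneSquare B → 1 ≤ volume B →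
    MemLp (pointCount X B) (ENNReal.ofReal p) P ∧
    ∫ ω, |pointCount X B ω - ∫ ω', pointCount X B ω' ∂P| ^ p ∂P
      ≤ γ * (volume B).toReal ^ ((1 - ε) * p / 2)

/-!
Write `N = X(B)` and `T = E N`. The theorem follows from the bound
`E exp (s (N - T)) ≤ exp (s² Var N)` for `|s| ≤ 1`
(`memLp_and_integral_exp_pointCount_le`), used at the scale `s = 1 / √(max (Var N) 1)`
(`integral_abs_sub_rpow_le`); the second part applies the first to squares. The bound is the one satisfied by sums of independent Bernoulli variables, and the point
is that `N` is a limit of such sums.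

The diagonal is a null set of the product space, so `T = ∫_B K x x dx` need not be the trace of the
integral operator with kernel `K`; for instance `K x y = 1_{x = y}` gives the Poisson process on
`ℝ^d` for `d ≥ 1`. The operator is therefore replaced by random finite matrices.

* The factorial moments of `N` are `M k = ∫_{B^k} det (K (x i) (x j)) dx`
  (`lintegral_descFactorial_eq`). The definition of a determinantal process gives this only for
  disjoint sets; `B` is cut into ever finer cells, which finally hold at most one point each.
* Let `w = K x x / T`, a probability density on `B`, and `L = K x y / √(w x w y)`, whose diagonal is
  `T`. For `n` independent points with density `w`, the Hermitian matrix `A = L (x i) (x j) / n` has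
  trace `T` and nonnegative minors, hence nonnegative eigenvalues. The `k`-th elementary symmetric
  polynomial of the eigenvalues times `k!` is an average of `det (L (x (f i)) (x (f j)))` over all
  maps `f`, and converges to `M k` in `L²` (`isLimitOfEigenvalueMoments_integral`). Choosing
  realizations yields deterministic eigenvalue families.
* The generating function `E (1 + z)^N = ∑ z^k M k / k!` is thus a limit of polynomials
  `∏ (1 + z l i)` with `l i ≥ 0`. It is positive on `(-1, 0]`, so the roots `-1 / l i` leave
  every compact part of this interval, that is, `l i ≤ 1 + δ` eventually. The elementary estimate for Bernoulli
  variables passes to the limit (`generatingFunction_le_exp`).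
-/

/-! ### Minors and eigenvalues of Hermitian matrices -/

open scoped Nat in
/-- Summing over all maps `Fin k → ι` counts every principal minor of order `k` exactly `k!` times,
once for each enumeration of its index set. -/
theorem sum_det_submatrix_eq {ι R : Type*} [Fintype ι] [DecidableEq ι] [CommRing R]
    (A : Matrix ι ι R) (k : ℕ) :
    ∑ f : Fin k → ι, (A.submatrix f f).det =
      k ! * ∑ s ∈ Finset.univ.powersetCard k,
        (A.submatrix (Subtype.val : s → ι) (Subtype.val : s → ι)).det := by
  classical
  have hzero : ∀ f : Fin k → ι, ¬ Function.Injective f → (A.submatrix f f).det = 0 := by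
    intro f hf
    simp only [Function.Injective, not_forall] at hf
    obtain ⟨i, j, hij, hne⟩ := hf
    exact Matrix.det_zero_of_row_eq hne (by ext l; simp [hij])
  rw [← Finset.sum_filter_of_ne (p := Function.Injective)
    (fun f _ h => by by_contra hf; exact h (hzero f hf))]
  rw [← Finset.sum_fiberwise_of_maps_to (t := Finset.univ.powersetCard k)
    (g := fun f => Finset.univ.image f)
    (fun f hf => by
      rw [Finset.mem_powersetCard]
      refine ⟨Finset.subset_univ _, ?_⟩
      rw [Finset.card_image_of_injective _ (Finset.mem_filter.1 hf).2]; simp), Finset.mul_sum]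
  refine Finset.sum_congr rfl fun s hs => ?_
  have hcard : Fintype.card (Fin k) = Fintype.card s := by
    simp [(Finset.mem_powersetCard.1 hs).2]
  have hconst : ∀ f ∈ (Finset.univ.filter Function.Injective).filter
      (fun f : Fin k → ι => Finset.univ.image f = s),
      (A.submatrix f f).det = (A.submatrix (Subtype.val : s → ι) (Subtype.val : s → ι)).det := by
    intro f hf
    simp only [Finset.mem_filter, Finset.mem_univ, true_and] at hf
    have hm : ∀ i, f i ∈ s := fun i => by rw [← hf.2]; simp
    let g : Fin k → s := fun i => ⟨f i, hm i⟩
    have hg : Function.Bijective g := by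
      rw [Fintype.bijective_iff_injective_and_card]
      exact ⟨fun i j h => hf.1 (congrArg Subtype.val h), hcard⟩
    rw [← Matrix.det_submatrix_equiv_self (Equiv.ofBijective g hg)]
    rfl
  rw [Finset.sum_congr rfl hconst, Finset.sum_const, nsmul_eq_mul]
  congr 2
  have e : (Fin k ≃ s) ≃ {f : Fin k → ι // f ∈ (Finset.univ.filter Function.Injective).filter
      (fun f : Fin k → ι => Finset.univ.image f = s)} :=
    { toFun := fun e => ⟨fun i => e i, by
        simp only [Finset.mem_filter, Finset.mem_univ, true_and]
        refine ⟨Subtype.val_injective.comp e.injective, ?_⟩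
        ext x
        simp only [Finset.mem_image, Finset.mem_univ, true_and]
        exact ⟨fun ⟨i, hi⟩ => hi ▸ (e i).2, fun hx => ⟨e.symm ⟨x, hx⟩, by simp⟩⟩⟩
      invFun := fun f => Equiv.ofBijective (fun i => (⟨f.1 i, by
          have := f.2
          simp only [Finset.mem_filter, Finset.mem_univ, true_and] at this
          exact this.2.subset (Finset.mem_image_of_mem _ (Finset.mem_univ i))⟩ : s)) (by
          have := f.2
          simp only [Finset.mem_filter, Finset.mem_univ, true_and] at this
          rw [Fintype.bijective_iff_injective_and_card]
          exact ⟨fun i j h => this.1 (congrArg Subtype.val h), hcard⟩)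
      left_inv := fun e => by ext; rfl
      right_inv := fun f => by ext; rfl }
  have h1 := Fintype.card_congr e
  rw [Fintype.card_coe] at h1
  rw [← h1, Fintype.card_equiv (Fintype.equivOfCardEq hcard), Fintype.card_fin]

open scoped Nat in
/-- The expansion of `det (1 + z A)` in `z`, its coefficients written as sums of minors over *all*
maps `Fin k → ι`: a map that is not injective contributes a determinant with equal rows. -/
theorem det_one_add_smul_eq_sum {ι : Type*} [Fintype ι] [DecidableEq ι]
    (A : Matrix ι ι ℂ) (z : ℂ) :
    (1 + z • A).det = ∑ k ∈ Finset.range (Fintype.card ι + 1),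
      z ^ k * (∑ f : Fin k → ι, (A.submatrix f f).det) / k ! := by
  have h1 : (1 + z • A).det =
      ((1 + (Polynomial.X : Polynomial ℂ) • A.map Polynomial.C).det).eval z := by
    rw [← Polynomial.coe_evalRingHom, RingHom.map_det]
    congr 1
    ext i j
    simp [Matrix.one_apply, apply_ite (Polynomial.eval z)]
    ring
  have h2 : ((1 + (Polynomial.X : Polynomial ℂ) • A.map Polynomial.C).det).natDegree
      ≤ Fintype.card ι := by
    have := Polynomial.natDegree_det_X_add_C_le A 1
    rw [add_comm]
    simpa using this
  rw [h1, Polynomial.eval_eq_sum_range' (Nat.lt_succ_of_le h2)]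
  refine Finset.sum_congr rfl fun k _ => ?_
  rw [Matrix.coeff_det_one_add_X_smul_eq_sum_minors, sum_det_submatrix_eq]
  have : ((k ! : ℕ) : ℂ) ≠ 0 := by exact_mod_cast k.factorial_ne_zero
  field_simp

theorem Matrix.IsHermitian.det_one_add_smul {ι : Type*} [Fintype ι] [DecidableEq ι]
    {A : Matrix ι ι ℂ} (hA : A.IsHermitian) (z : ℂ) :
    (1 + z • A).det = ∏ i, (1 + z * (hA.eigenvalues i : ℂ)) := by
  have h := hA.spectral_theorem
  set φ := Unitary.conjStarAlgAut ℂ (Matrix ι ι ℂ) hA.eigenvectorUnitary with hφ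
  set D : Matrix ι ι ℂ := Matrix.diagonal (RCLike.ofReal ∘ hA.eigenvalues) with hD
  have h2 : 1 + z • A = φ (1 + z • D) := by
    rw [map_add, map_one, map_smul, ← h]
  have h3 : (φ (1 + z • D)).det = (1 + z • D).det := by
    rw [hφ, Unitary.conjStarAlgAut_apply, Matrix.det_mul_comm, ← Matrix.mul_assoc]
    simp
  rw [h2, h3]
  have h4 : 1 + z • D = Matrix.diagonal (fun i => 1 + z * (hA.eigenvalues i : ℂ)) := by
    ext i j
    by_cases hij : i = j
    · subst hij; simp [hD]
    · simp [hD, hij]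
  rw [h4, Matrix.det_diagonal]

theorem Matrix.IsHermitian.trace_mul_self_eq {ι : Type*} [Fintype ι] [DecidableEq ι]
    {A : Matrix ι ι ℂ} (hA : A.IsHermitian) :
    (A * A).trace = ∑ i, ((hA.eigenvalues i : ℂ)) ^ 2 := by
  have h := hA.spectral_theorem
  set φ := Unitary.conjStarAlgAut ℂ (Matrix ι ι ℂ) hA.eigenvectorUnitary with hφ
  set D : Matrix ι ι ℂ := Matrix.diagonal (RCLike.ofReal ∘ hA.eigenvalues) with hD
  have h2 : A * A = φ (D * D) := by
    rw [map_mul, ← h]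
  have h3 : (φ (D * D)).trace = (D * D).trace := by
    rw [hφ, Unitary.conjStarAlgAut_apply, Matrix.trace_mul_comm, ← Matrix.mul_assoc]
    simp
  rw [h2, h3]
  simp [hD, Matrix.trace, sq]

theorem Matrix.IsHermitian.det_submatrix_re {ι κ : Type*} [Fintype κ] [DecidableEq κ]
    {A : Matrix ι ι ℂ} (hA : A.IsHermitian) (f : κ → ι) :
    (((A.submatrix f f).det.re : ℝ) : ℂ) = (A.submatrix f f).det := by
  have h := (hA.submatrix f)
  rw [h.det_eq_prod_eigenvalues]
  norm_cast

/-- The sum of the minors of order `k` of a matrix, over all maps from `Fin k` to the index type;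
for a Hermitian matrix it is `k!` times the `k`-th elementary symmetric polynomial in the
eigenvalues. The real part makes it a real number. -/
noncomputable def minorSum {ι : Type*} [Fintype ι] (A : Matrix ι ι ℂ) (k : ℕ) : ℝ :=
  ∑ f : Fin k → ι, (A.submatrix f f).det.re

open scoped Nat in
theorem hasSum_minorSum {ι : Type*} [Fintype ι] [DecidableEq ι]
    {A : Matrix ι ι ℂ} (hA : A.IsHermitian) (z : ℝ) :
    HasSum (fun k => z ^ k * minorSum A k / k !) (∏ i, (1 + z * hA.eigenvalues i)) := by
  have h1 : ∏ i, (1 + z * hA.eigenvalues i) =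
      ∑ k ∈ Finset.range (Fintype.card ι + 1), z ^ k * minorSum A k / k ! := by
    have h2 := det_one_add_smul_eq_sum A z
    rw [hA.det_one_add_smul] at h2
    have h3 : ∀ k, (∑ f : Fin k → ι, (A.submatrix f f).det) = ((minorSum A k : ℝ) : ℂ) := by
      intro k
      simp only [minorSum, Complex.ofReal_sum]
      exact Finset.sum_congr rfl fun f _ => (hA.det_submatrix_re f).symm
    simp only [h3] at h2
    exact_mod_cast h2
  rw [h1]
  refine hasSum_sum_of_ne_finset_zero fun k hk => ?_
  have hk' : Fintype.card ι < k := by simpa [Nat.lt_succ_iff] using hk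
  have : minorSum A k = 0 := by
    refine Finset.sum_eq_zero fun f _ => ?_
    have hf : ¬ Function.Injective f := fun hf => by
      have := Fintype.card_le_of_injective f hf
      simp at this; omega
    simp only [Function.Injective, not_forall] at hf
    obtain ⟨i, j, hij, hne⟩ := hf
    rw [Matrix.det_zero_of_row_eq hne (by ext l; simp [hij])]
    simp
  simp [this]

theorem sum_eigenvalues_eq {ι : Type*} [Fintype ι] [DecidableEq ι]
    {A : Matrix ι ι ℂ} (hA : A.IsHermitian) : ∑ i, hA.eigenvalues i = A.trace.re := by
  rw [hA.trace_eq_sum_eigenvalues]; simp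

theorem sum_sq_eigenvalues_eq {ι : Type*} [Fintype ι] [DecidableEq ι]
    {A : Matrix ι ι ℂ} (hA : A.IsHermitian) :
    ∑ i, hA.eigenvalues i ^ 2 = (∑ i, hA.eigenvalues i) ^ 2 - minorSum A 2 := by
  have h1 : ((minorSum A 2 : ℝ) : ℂ) = A.trace ^ 2 - (A * A).trace := by
    rw [minorSum, Complex.ofReal_sum, Finset.sum_congr rfl fun f _ => hA.det_submatrix_re f]
    simp only [Matrix.det_fin_two, Matrix.submatrix_apply]
    rw [← (finTwoArrowEquiv ι).symm.sum_comp, Fintype.sum_prod_type]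
    simp [Finset.sum_sub_distrib, Matrix.trace, Matrix.mul_apply, sq, Finset.sum_mul_sum]
  rw [hA.trace_mul_self_eq, hA.trace_eq_sum_eigenvalues] at h1
  have h2 : ((minorSum A 2 : ℝ)) = (∑ i, hA.eigenvalues i) ^ 2 - ∑ i, hA.eigenvalues i ^ 2 := by
    apply Complex.ofReal_injective
    simpa using h1
  linarith

/-- If all minor sums are nonnegative, then `det (1 + z A) ≥ 1` for `z ≥ 0`, which rules out
negative eigenvalues. -/
theorem eigenvalues_nonneg_of_minorSum_nonneg {ι : Type*} [Fintype ι] [DecidableEq ι]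
    {A : Matrix ι ι ℂ} (hA : A.IsHermitian) (h : ∀ k, 0 ≤ minorSum A k) (i : ι) :
    0 ≤ hA.eigenvalues i := by
  by_contra! hi
  set z := -(hA.eigenvalues i)⁻¹ with hz
  have hzpos : 0 < z := by rw [hz]; exact neg_pos.2 (inv_lt_zero.2 hi)
  have hs := hasSum_minorSum hA z
  have h0 : ∏ j, (1 + z * hA.eigenvalues j) = 0 := by
    refine Finset.prod_eq_zero (Finset.mem_univ i) ?_
    rw [hz, neg_mul, inv_mul_cancel₀ hi.ne]; ring
  rw [h0] at hs
  have h1 := le_hasSum hs 0 (fun k _ => by have := h k; positivity)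
  simp [minorSum] at h1
  linarith

/-- The eigenvalues are nonnegative with arithmetic mean `T`, so that
`∏ (λ i / T) ≤ exp (∑ (λ i / T - 1)) = 1`. -/
theorem det_re_le_of_diag {κ : Type*} [Fintype κ] [DecidableEq κ]
    {A : Matrix κ κ ℂ} (hA : A.IsHermitian) (h : ∀ k, 0 ≤ minorSum A k) {T : ℝ} (hT : 0 < T)
    (hd : ∀ i, A i i = T) : A.det.re ≤ T ^ Fintype.card κ := by
  have h1 : A.det.re = ∏ i, hA.eigenvalues i := by
    rw [hA.det_eq_prod_eigenvalues]; norm_cast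
  have h2 : ∑ i, hA.eigenvalues i = Fintype.card κ * T := by
    rw [sum_eigenvalues_eq]; simp [Matrix.trace, hd]
  have h3 : ∏ i, (hA.eigenvalues i / T) ≤ ∏ i, Real.exp (hA.eigenvalues i / T - 1) := by
    refine Finset.prod_le_prod (fun i _ => ?_) fun i _ => ?_
    · exact div_nonneg (eigenvalues_nonneg_of_minorSum_nonneg hA h i) hT.le
    · have := Real.add_one_le_exp (hA.eigenvalues i / T - 1)
      linarith
  rw [← Real.exp_sum, Finset.sum_sub_distrib, ← Finset.sum_div, h2, Finset.prod_div_distrib] at h3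
  simp only [Finset.prod_const, Finset.card_univ, Finset.sum_const, nsmul_eq_mul, mul_one] at h3
  rw [mul_div_assoc, div_self hT.ne', mul_one, sub_self, Real.exp_zero,
    div_le_one (by positivity)] at h3
  rw [h1]; exact h3

/-! ### Generating functions and exponential moments -/

open scoped Nat in
theorem hasSum_one_add_pow (z : ℝ) (n : ℕ) :
    HasSum (fun k => z ^ k * (n.descFactorial k : ℝ) / k !) ((1 + z) ^ n) := by
  have h : (1 + z) ^ n = ∑ k ∈ Finset.range (n + 1), z ^ k * (n.descFactorial k : ℝ) / k ! := by
    rw [add_comm, add_pow]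
    refine Finset.sum_congr rfl fun k _ => ?_
    rw [Nat.descFactorial_eq_factorial_mul_choose]
    have : ((k ! : ℕ) : ℝ) ≠ 0 := by exact_mod_cast k.factorial_ne_zero
    push_cast
    field_simp
    simp
  rw [h]
  refine hasSum_sum_of_ne_finset_zero fun k hk => ?_
  have hk' : n < k := by simpa [Nat.lt_succ_iff] using hk
  simp [Nat.descFactorial_of_lt hk']

open scoped Nat in
theorem summable_pow_mul_of_le {z T : ℝ} {M : ℕ → ℝ}
    (hM : ∀ k, 0 ≤ M k ∧ M k ≤ T ^ k) : Summable fun k => z ^ k * M k / k ! := by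
  refine Summable.of_norm_bounded (Real.summable_pow_div_factorial (|z| * T)) fun k => ?_
  rw [Real.norm_eq_abs, abs_div, abs_mul, abs_pow, abs_of_nonneg (hM k).1, mul_pow,
    abs_of_nonneg (a := ((k ! : ℕ) : ℝ)) (by positivity)]
  have := (hM k).2
  gcongr

section GeneratingFunction

open scoped Nat

variable {Ω : Type*} [MeasurableSpace Ω] {P : Measure Ω} {N : Ω → ℕ} {T : ℝ} {M : ℕ → ℝ}

theorem integrable_one_add_pow (hN : Measurable N)
    (hi : ∀ k, Integrable (fun ω => ((N ω).descFactorial k : ℝ)) P)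
    (hI : ∀ k, ∫ ω, ((N ω).descFactorial k : ℝ) ∂P = M k)
    (hM : ∀ k, 0 ≤ M k ∧ M k ≤ T ^ k) (z : ℝ) :
    Integrable (fun ω => (1 + z) ^ N ω) P := by
  have hpos : Integrable (fun ω => (1 + |z|) ^ N ω) P := by
    refine ⟨(measurable_from_nat.comp hN).aestronglyMeasurable, ?_⟩
    rw [hasFiniteIntegral_iff_ofReal (ae_of_all _ fun ω => by positivity)]
    have h1 : ∀ ω, ENNReal.ofReal ((1 + |z|) ^ N ω) =
        ∑' k, ENNReal.ofReal (|z| ^ k * ((N ω).descFactorial k : ℝ) / k !) := fun ω => by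
      rw [← (hasSum_one_add_pow |z| (N ω)).tsum_eq]
      exact ENNReal.ofReal_tsum_of_nonneg (fun k => by positivity)
        (hasSum_one_add_pow |z| (N ω)).summable
    simp only [h1]
    rw [lintegral_tsum
      (f := fun k ω => ENNReal.ofReal (|z| ^ k * ((N ω).descFactorial k : ℝ) / k !))
      fun k => ((measurable_from_nat (f := fun n => ENNReal.ofReal
        (|z| ^ k * (n.descFactorial k : ℝ) / k !))).comp hN).aemeasurable]
    have h2 : ∀ k, ∫⁻ ω, ENNReal.ofReal (|z| ^ k * ((N ω).descFactorial k : ℝ) / k !) ∂P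
        = ENNReal.ofReal (|z| ^ k * M k / k !) := fun k => by
      rw [← ofReal_integral_eq_lintegral_ofReal (((hi k).const_mul _).div_const _)
        (ae_of_all _ fun ω => by positivity), integral_div, integral_const_mul, hI]
    simp only [h2]
    rw [← ENNReal.ofReal_tsum_of_nonneg (fun k => by have := (hM k).1; positivity)
      (summable_pow_mul_of_le hM)]
    exact ENNReal.ofReal_lt_top
  refine hpos.mono' (measurable_from_nat.comp hN).aestronglyMeasurable (ae_of_all _ fun ω => ?_)
  rw [norm_pow]
  gcongr
  simpa using norm_add_le (1 : ℝ) z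

/-- The probability generating function is the exponential generating function of the factorial
moments. -/
theorem hasSum_integral_one_add_pow
    (hi : ∀ k, Integrable (fun ω => ((N ω).descFactorial k : ℝ)) P)
    (hI : ∀ k, ∫ ω, ((N ω).descFactorial k : ℝ) ∂P = M k)
    (hM : ∀ k, 0 ≤ M k ∧ M k ≤ T ^ k) (z : ℝ) :
    HasSum (fun k => z ^ k * M k / k !) (∫ ω, (1 + z) ^ N ω ∂P) := by
  have h1 := hasSum_integral_of_summable_integral_norm (μ := P)
    (F := fun k ω => z ^ k * ((N ω).descFactorial k : ℝ) / k !)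
    (fun k => ((hi k).const_mul _).div_const _) (by
      have : ∀ k, ∫ ω, ‖z ^ k * ((N ω).descFactorial k : ℝ) / (k ! : ℝ)‖ ∂P
          = |z| ^ k * M k / k ! := fun k => by
        rw [← hI k, ← integral_const_mul, ← integral_div]
        refine integral_congr_ae (ae_of_all _ fun ω => ?_)
        simp
      simp only [this]
      exact summable_pow_mul_of_le hM)
  simpa [integral_div, integral_const_mul, hI, (hasSum_one_add_pow z _).tsum_eq] using h1

end GeneratingFunction

/-- The centred moment generating function of a Bernoulli variable is at most `exp (s² Var)`. -/
theorem one_add_exp_sub_one_mul_le {s l : ℝ} (hs : |s| ≤ 1) (h0 : 0 ≤ l) (h1 : l ≤ 1) :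
    1 + (Real.exp s - 1) * l ≤ Real.exp (s * l + s ^ 2 * (l - l ^ 2)) := by
  -- Both values `-l` and `1 - l` of the centred variable are at most `1` in absolute value.
  have hexp : ∀ y : ℝ, |y| ≤ 1 → Real.exp y ≤ 1 + y + y ^ 2 := fun y hy => by
    have := Real.abs_exp_sub_one_sub_id_le hy
    linarith [(abs_le.1 this).2]
  have ha : |(-(s * l))| ≤ 1 := by
    rw [abs_neg, abs_mul, abs_of_nonneg h0]
    exact mul_le_one₀ hs h0 h1
  have hb : |s * (1 - l)| ≤ 1 := by
    rw [abs_mul, abs_of_nonneg (sub_nonneg.2 h1)]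
    exact mul_le_one₀ hs (by linarith) (by linarith)
  have h2 := hexp _ ha
  have h3 := hexp _ hb
  have e1 : Real.exp s = Real.exp (s * l) * Real.exp (s * (1 - l)) := by
    rw [← Real.exp_add]; ring_nf
  have e2 : (1 : ℝ) = Real.exp (s * l) * Real.exp (-(s * l)) := by
    rw [← Real.exp_add]; simp
  have e3 : 1 + (Real.exp s - 1) * l =
      Real.exp (s * l) * ((1 - l) * Real.exp (-(s * l)) + l * Real.exp (s * (1 - l))) := by
    calc 1 + (Real.exp s - 1) * l = 1 * (1 - l) + Real.exp s * l := by ring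
      _ = _ := by rw [e1]; nth_rewrite 1 [e2]; ring
  rw [e3, Real.exp_add]
  refine mul_le_mul_of_nonneg_left ?_ (Real.exp_pos _).le
  calc (1 - l) * Real.exp (-(s * l)) + l * Real.exp (s * (1 - l))
      ≤ (1 - l) * (1 + -(s * l) + (-(s * l)) ^ 2) +
        l * (1 + s * (1 - l) + (s * (1 - l)) ^ 2) :=
        add_le_add (mul_le_mul_of_nonneg_left h2 (by linarith))
          (mul_le_mul_of_nonneg_left h3 h0)
    _ = s ^ 2 * (l - l ^ 2) + 1 := by ring
    _ ≤ _ := Real.add_one_le_exp _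

theorem prod_one_add_le_exp {m : ℕ} (l : Fin m → ℝ) {s : ℝ} (hs : |s| ≤ 1)
    (h : ∀ i, 0 ≤ l i ∧ l i ≤ 1) :
    ∏ i, (1 + (Real.exp s - 1) * l i) ≤
      Real.exp (s * ∑ i, l i + s ^ 2 * (∑ i, l i - ∑ i, l i ^ 2)) := by
  calc ∏ i, (1 + (Real.exp s - 1) * l i) ≤
      ∏ i, Real.exp (s * l i + s ^ 2 * (l i - l i ^ 2)) := by
        refine Finset.prod_le_prod (fun i _ => ?_)
          fun i _ => one_add_exp_sub_one_mul_le hs (h i).1 (h i).2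
        have := Real.exp_pos s
        nlinarith [(h i).1, (h i).2]
    _ = _ := by
        rw [← Real.exp_sum, Finset.sum_add_distrib, ← Finset.mul_sum, ← Finset.mul_sum,
          Finset.sum_sub_distrib]

open scoped Nat in
/-- `M` is a limit of the factorial moments `c k = k! e_k(l)` of finite nonnegative families `l`
with sum `T`. When all `l i ≤ 1` these are the factorial moments of a sum of independent Bernoulli
variables with parameters `l i`; the bound by `1` is not part of the definition. The coefficients
`c` are given through the generating polynomial `∏ (1 + z l i)`. -/
def IsLimitOfEigenvalueMoments (T : ℝ) (M : ℕ → ℝ) : Prop :=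
  ∀ n : ℕ, ∃ (m : ℕ) (l : Fin m → ℝ) (c : ℕ → ℝ), (∀ i, 0 ≤ l i) ∧ ∑ i, l i = T ∧
    ∑ i, l i ^ 2 = T ^ 2 - c 2 ∧ (∀ k, 0 ≤ c k ∧ c k ≤ T ^ k) ∧
    (∀ z : ℝ, HasSum (fun k => z ^ k * c k / k !) (∏ i, (1 + z * l i))) ∧
    ∀ k ≤ n, |c k - M k| ≤ 1 / ((n : ℝ) + 1)

open Filter Topology in
open scoped Nat in
/-- A generating function `D(z) = E (1 + z)^N` that is a limit of polynomials `∏ (1 + z l i)` with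
nonnegative `l` satisfies the moment generating function bound of sums of independent Bernoulli
variables. Positivity of `D` on `(-1, 0]` forces the roots `-1 / l i` out of any interval
`[-1 / (1 + δ), 0]`, so that eventually all `l i ≤ 1 + δ`. -/
theorem generatingFunction_le_exp {T : ℝ} {M : ℕ → ℝ} {D : ℝ → ℝ}
    (hM : ∀ k, 0 ≤ M k ∧ M k ≤ T ^ k) (hD : ∀ z, HasSum (fun k => z ^ k * M k / k !) (D z))
    (hpos : ∀ r ∈ Set.Ioo (-1 : ℝ) 0, ∃ η > 0, ∀ z ∈ Set.Icc r 0, η ≤ D z)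
    (hlim : IsLimitOfEigenvalueMoments T M) {s : ℝ} (hs : |s| ≤ 1) :
    D (Real.exp s - 1) ≤ Real.exp (s * T + s ^ 2 * (T - (T ^ 2 - M 2))) := by
  choose m l c hl hsum hsq hc hprod hcM using hlim
  have hcl : ∀ k, Tendsto (fun n => c n k) atTop (𝓝 (M k)) := fun k => by
    rw [tendsto_iff_dist_tendsto_zero]
    refine squeeze_zero' (Eventually.of_forall fun _ => dist_nonneg) ?_
      tendsto_one_div_add_atTop_nhds_zero_nat
    filter_upwards [eventually_ge_atTop k] with n hn
    rw [Real.dist_eq]; exact hcM n k hn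
  have hT : 0 ≤ T := by simpa using (hc 0 1).1.trans (hc 0 1).2
  have hdiff : ∀ n k, |c n k - M k| ≤ T ^ k := fun n k => by
    rw [abs_le]; constructor <;> linarith [(hc n k).1, (hc n k).2, (hM k).1, (hM k).2]
  -- The polynomials converge to `D` uniformly on `[-1, 1]`.
  have hη : Tendsto (fun n => ∑' k, |c n k - M k| / (k ! : ℝ)) atTop (𝓝 0) := by
    have := tendsto_tsum_of_dominated_convergence (𝓕 := atTop)
      (f := fun n k => |c n k - M k| / (k ! : ℝ)) (g := fun _ => 0)
      (Real.summable_pow_div_factorial T) (fun k => by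
        have h := ((hcl k).sub_const (M k)).abs.div_const (k ! : ℝ)
        simpa using h) (Eventually.of_forall fun n k => by
          rw [Real.norm_eq_abs, abs_of_nonneg (by positivity)]
          have := hdiff n k
          gcongr)
    simpa using this
  have hunif : ∀ n z, |z| ≤ 1 → D z - ∏ i, (1 + z * l n i) ≤ ∑' k, |c n k - M k| / (k ! : ℝ) := by
    intro n z hz
    have h1 := (hD z).sub (hprod n z)
    rw [← h1.tsum_eq]
    refine h1.summable.tsum_le_tsum (fun k => ?_) ?_
    · calc z ^ k * M k / (k ! : ℝ) - z ^ k * c n k / (k ! : ℝ)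
          = z ^ k * (M k - c n k) / (k ! : ℝ) := by ring
        _ ≤ |z ^ k * (M k - c n k)| / (k ! : ℝ) := by gcongr; exact le_abs_self _
        _ ≤ |c n k - M k| / (k ! : ℝ) := by
          rw [abs_mul, abs_pow, abs_sub_comm]
          gcongr
          exact mul_le_of_le_one_left (abs_nonneg _) (pow_le_one₀ (abs_nonneg _) hz)
    · refine Summable.of_nonneg_of_le (fun k => by positivity) (fun k => ?_)
        (Real.summable_pow_div_factorial T)
      have := hdiff n k
      gcongr
  -- Hence no `l i` exceeds `1 + δ` for large `n`.
  have hle : ∀ δ > 0, ∀ᶠ n in atTop, ∀ i, l n i ≤ 1 + δ := by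
    intro δ hδ
    obtain ⟨η, hη0, hηD⟩ := hpos (-(1 + δ)⁻¹) ⟨by
      rw [neg_lt_neg_iff]; exact inv_lt_one_of_one_lt₀ (by linarith), by
      rw [neg_lt_zero]; positivity⟩
    filter_upwards [hη.eventually (gt_mem_nhds hη0)] with n hn i
    by_contra! hi
    have hli : 0 < l n i := by linarith
    have hinv : (l n i)⁻¹ ≤ (1 + δ)⁻¹ := inv_anti₀ (by linarith) hi.le
    have hinv1 : (1 + δ)⁻¹ ≤ 1 := inv_le_one_of_one_le₀ (by linarith)
    have h0 : ∏ j, (1 + (-(l n i)⁻¹) * l n j) = 0 := by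
      refine Finset.prod_eq_zero (Finset.mem_univ i) ?_
      rw [neg_mul, inv_mul_cancel₀ hli.ne']; ring
    have h1 := hunif n (-(l n i)⁻¹) (by
      rw [abs_neg, abs_of_pos (by positivity)]; linarith)
    have h2 := hηD (-(l n i)⁻¹) ⟨by linarith, by rw [neg_nonpos]; positivity⟩
    rw [h0] at h1
    linarith
  have hconv : ∀ z, Tendsto (fun n => ∏ i, (1 + z * l n i)) atTop (𝓝 (D z)) := by
    intro z
    rw [← (hD z).tsum_eq]
    simp only [← fun n => (hprod n z).tsum_eq]
    refine tendsto_tsum_of_dominated_convergence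
      (Real.summable_pow_div_factorial (|z| * T)) (fun k => ?_)
      (Eventually.of_forall fun n k => ?_)
    · exact ((hcl k).const_mul _).div_const _
    · rw [Real.norm_eq_abs, abs_div, abs_mul, abs_pow, abs_of_nonneg (hc n k).1, mul_pow,
        abs_of_nonneg (a := ((k ! : ℕ) : ℝ)) (by positivity)]
      have := (hc n k).2
      gcongr
  -- After division by `1 + δ` the families consist of Bernoulli parameters; then `δ` tends to `0`.
  have hδbound : ∀ δ > 0, D ((Real.exp s - 1) / (1 + δ)) ≤
      Real.exp (s * (T / (1 + δ)) + s ^ 2 * (T / (1 + δ) - (T ^ 2 - M 2) / (1 + δ) ^ 2)) := by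
    intro δ hδ
    have hR : Tendsto (fun n => Real.exp (s * (T / (1 + δ)) +
        s ^ 2 * (T / (1 + δ) - (T ^ 2 - c n 2) / (1 + δ) ^ 2))) atTop
        (𝓝 (Real.exp (s * (T / (1 + δ)) +
          s ^ 2 * (T / (1 + δ) - (T ^ 2 - M 2) / (1 + δ) ^ 2)))) := by
      refine (Real.continuous_exp.tendsto _).comp ?_
      exact ((((hcl 2).const_sub _).div_const _).const_sub _).const_mul _ |>.const_add _
    refine le_of_tendsto_of_tendsto (hconv _) hR ?_
    filter_upwards [hle δ hδ] with n hn
    have h1δ : 0 < 1 + δ := by linarith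
    have := prod_one_add_le_exp (fun i => l n i / (1 + δ)) hs
      (fun i => ⟨div_nonneg (hl n i) h1δ.le, (div_le_one h1δ).2 (hn i)⟩)
    simp only [div_pow, ← Finset.sum_div, hsum, hsq] at this
    refine le_trans (le_of_eq ?_) this
    refine Finset.prod_congr rfl fun i _ => ?_
    ring
  have hδ : Tendsto (fun n : ℕ => 1 + 1 / ((n : ℝ) + 1)) atTop (𝓝 1) := by
    simpa using tendsto_one_div_add_atTop_nhds_zero_nat.const_add (1 : ℝ)
  have hDcont : Tendsto (fun n : ℕ => D ((Real.exp s - 1) / (1 + 1 / ((n : ℝ) + 1)))) atTop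
      (𝓝 (D (Real.exp s - 1))) := by
    set z := Real.exp s - 1
    rw [← (hD z).tsum_eq]
    simp only [← fun w => (hD w).tsum_eq]
    refine tendsto_tsum_of_dominated_convergence
      (Real.summable_pow_div_factorial (|z| * T)) (fun k => ?_)
      (Eventually.of_forall fun n k => ?_)
    · have : Tendsto (fun n : ℕ => z / (1 + 1 / ((n : ℝ) + 1))) atTop (𝓝 z) := by
        simpa [Pi.div_def] using (tendsto_const_nhds (x := z)).div hδ one_ne_zero
      exact ((this.pow k).mul_const _).div_const _
    · rw [Real.norm_eq_abs, abs_div, abs_mul, abs_pow, abs_of_nonneg (hM k).1, mul_pow,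
        abs_of_nonneg (a := ((k ! : ℕ) : ℝ)) (by positivity), abs_div]
      have := (hM k).2
      have h0 := (hM k).1
      have h2 : |z| / |1 + 1 / ((n : ℝ) + 1)| ≤ |z| := by
        refine div_le_self (abs_nonneg _) ?_
        rw [abs_of_pos (by positivity)]
        have : 0 ≤ 1 / ((n : ℝ) + 1) := by positivity
        linarith
      gcongr
  refine le_of_tendsto_of_tendsto hDcont ?_
    (Eventually.of_forall fun n : ℕ => hδbound (1 / ((n : ℝ) + 1)) (by positivity))
  refine (Real.continuous_exp.tendsto _).comp ?_
  have hTδ := (tendsto_const_nhds (x := T)).div hδ one_ne_zero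
  have hVδ := (tendsto_const_nhds (x := T ^ 2 - M 2)).div (hδ.pow 2) (by norm_num)
  have := (hTδ.const_mul s).add ((hTδ.sub hVδ).const_mul (s ^ 2))
  simpa using this

section ExponentialMoments

variable {Ω : Type*} [MeasurableSpace Ω] {P : Measure Ω}

theorem integrable_exp_and_le_of_factorialMoments [IsProbabilityMeasure P] {N : Ω → ℕ} {T : ℝ}
    {M : ℕ → ℝ} (hN : Measurable N)
    (hi : ∀ k, Integrable (fun ω => ((N ω).descFactorial k : ℝ)) P)
    (hI : ∀ k, ∫ ω, ((N ω).descFactorial k : ℝ) ∂P = M k)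
    (hM : ∀ k, 0 ≤ M k ∧ M k ≤ T ^ k) (hlim : IsLimitOfEigenvalueMoments T M)
    {s : ℝ} (hs : |s| ≤ 1) :
    Integrable (fun ω => Real.exp (s * N ω)) P ∧
      ∫ ω, Real.exp (s * N ω) ∂P ≤ Real.exp (s * T + s ^ 2 * (T - (T ^ 2 - M 2))) := by
  have hint := integrable_one_add_pow hN hi hI hM
  have hexp : ∀ ω, Real.exp (s * N ω) = (1 + (Real.exp s - 1)) ^ N ω := fun ω => by
    rw [mul_comm, Real.exp_nat_mul]; ring
  simp only [hexp]
  refine ⟨hint _, ?_⟩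
  refine generatingFunction_le_exp (D := fun z => ∫ ω, (1 + z) ^ N ω ∂P) hM
    (hasSum_integral_one_add_pow hi hI hM) (fun r hr => ?_) hlim hs
  have hr1 : 0 < 1 + r := by linarith [hr.1]
  refine ⟨∫ ω, (1 + r) ^ N ω ∂P, ?_, fun z hz => ?_⟩
  · rw [gt_iff_lt, integral_pos_iff_support_of_nonneg (fun ω => by positivity) (hint r)]
    have : Function.support (fun ω => (1 + r) ^ N ω) = Set.univ := by
      ext ω; simp [hr1.ne']
    rw [this]; simp
  · refine integral_mono (hint r) (hint z) fun ω => ?_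
    have := hz.1
    simp only
    gcongr

end ExponentialMoments

open scoped Nat in
theorem rpow_le_mul_exp {p t : ℝ} (hp : 0 ≤ p) (ht : 0 ≤ t) :
    t ^ p ≤ (1 + (⌈p⌉₊ ! : ℝ)) * Real.exp t := by
  have h1 : t ^ p ≤ 1 + t ^ ⌈p⌉₊ := by
    rcases le_total t 1 with h | h
    · have := Real.rpow_le_one ht h hp
      have : 0 ≤ t ^ ⌈p⌉₊ := by positivity
      linarith
    · have h2 : t ^ p ≤ t ^ ((⌈p⌉₊ : ℕ) : ℝ) := Real.rpow_le_rpow_of_exponent_le h (Nat.le_ceil p)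
      rw [Real.rpow_natCast] at h2
      linarith
  have h2 : t ^ ⌈p⌉₊ ≤ (⌈p⌉₊ ! : ℝ) * Real.exp t := by
    have := Real.pow_div_factorial_le_exp t ht ⌈p⌉₊
    rwa [div_le_iff₀' (by positivity)] at this
  have h3 : 1 ≤ Real.exp t := Real.one_le_exp ht
  linarith

open scoped Nat in
/-- The constant in the central moment inequality of order `p`. -/
noncomputable def centralMomentConst (p : ℝ) : ℝ :=
  2 * (1 + (⌈p⌉₊ ! : ℝ)) * Real.exp 1

theorem centralMomentConst_pos (p : ℝ) : 0 < centralMomentConst p := by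
  unfold centralMomentConst; positivity

/-- A sub-exponential moment generating function with variance proxy `V` controls all central
moments by `V`; the inequality is used at the scale `s = 1 / √(max V 1)`. -/
theorem integral_abs_sub_rpow_le {Ω : Type*} [MeasurableSpace Ω] {P : Measure Ω} {Y : Ω → ℝ}
    {T V p : ℝ} (hV : 0 ≤ V) (hp : 0 ≤ p) (hY : ∀ s : ℝ, |s| ≤ 1 →
      Integrable (fun ω => Real.exp (s * Y ω)) P ∧
        ∫ ω, Real.exp (s * Y ω) ∂P ≤ Real.exp (s * T + s ^ 2 * V)) :
    ∫ ω, |Y ω - T| ^ p ∂P ≤ centralMomentConst p * (V ^ (p / 2) + 1) := by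
  set σ := Real.sqrt (max V 1) with hσ
  have hσ1 : 1 ≤ σ := by rw [hσ, Real.one_le_sqrt]; exact le_max_right _ _
  have hσ0 : 0 < σ := by linarith
  have hσ2 : σ ^ 2 = max V 1 := Real.sq_sqrt (by positivity)
  have hside : ∀ s : ℝ, |s| = σ⁻¹ → Integrable (fun ω => Real.exp (s * (Y ω - T))) P ∧
      ∫ ω, Real.exp (s * (Y ω - T)) ∂P ≤ Real.exp 1 := by
    intro s hs
    obtain ⟨h1, h2⟩ := hY s (hs.trans_le (inv_le_one_of_one_le₀ hσ1))
    have h3 : ∀ ω, Real.exp (s * (Y ω - T)) = Real.exp (-(s * T)) * Real.exp (s * Y ω) :=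
      fun ω => by rw [← Real.exp_add]; ring_nf
    simp only [h3]
    refine ⟨h1.const_mul _, ?_⟩
    rw [integral_const_mul]
    refine (mul_le_mul_of_nonneg_left h2 (Real.exp_pos _).le).trans ?_
    rw [← Real.exp_add, Real.exp_le_exp]
    have h4 : s ^ 2 * V ≤ 1 := by
      rw [← sq_abs, hs, inv_pow, hσ2, inv_mul_le_iff₀ (by positivity)]
      simp
    linarith
  obtain ⟨hi1, hb1⟩ := hside σ⁻¹ (abs_of_pos (by positivity))
  obtain ⟨hi2, hb2⟩ := hside (-σ⁻¹) (by rw [abs_neg]; exact abs_of_pos (by positivity))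
  have hpt : ∀ ω, |Y ω - T| ^ p ≤ σ ^ p * (1 + (Nat.factorial ⌈p⌉₊ : ℝ)) *
      (Real.exp (σ⁻¹ * (Y ω - T)) + Real.exp (-σ⁻¹ * (Y ω - T))) := by
    intro ω
    set y := Y ω - T
    have e : |y| = σ * |σ⁻¹ * y| := by
      rw [abs_mul, abs_of_pos (inv_pos.2 hσ0), ← mul_assoc, mul_inv_cancel₀ hσ0.ne', one_mul]
    rw [e, Real.mul_rpow hσ0.le (abs_nonneg _), mul_assoc]
    refine mul_le_mul_of_nonneg_left ?_ (by positivity)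
    refine (rpow_le_mul_exp hp (abs_nonneg _)).trans ?_
    refine mul_le_mul_of_nonneg_left ?_ (by positivity)
    rw [neg_mul]
    exact Real.exp_abs_le _
  have hσp : σ ^ p ≤ V ^ (p / 2) + 1 := by
    rw [hσ, Real.sqrt_eq_rpow, ← Real.rpow_mul (by positivity), one_div_mul_eq_div]
    rcases le_total V 1 with h | h
    · rw [max_eq_right h, Real.one_rpow]
      have : 0 ≤ V ^ (p / 2) := by positivity
      linarith
    · rw [max_eq_left h]; linarith
  calc ∫ ω, |Y ω - T| ^ p ∂P ≤ ∫ ω, σ ^ p * (1 + (Nat.factorial ⌈p⌉₊ : ℝ)) *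
      (Real.exp (σ⁻¹ * (Y ω - T)) + Real.exp (-σ⁻¹ * (Y ω - T))) ∂P :=
        integral_mono_of_nonneg (ae_of_all _ fun ω => by positivity)
          ((hi1.add hi2).const_mul _) (ae_of_all _ hpt)
    _ ≤ σ ^ p * (1 + (Nat.factorial ⌈p⌉₊ : ℝ)) * (Real.exp 1 + Real.exp 1) := by
        rw [integral_const_mul, integral_add hi1 hi2]
        gcongr
    _ = centralMomentConst p * σ ^ p := by unfold centralMomentConst; ring
    _ ≤ _ := mul_le_mul_of_nonneg_left hσp (centralMomentConst_pos p).le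

/-! ### Minors of a kernel at random points -/

open Filter Topology in
theorem tendsto_descFactorial_div_pow (m : ℕ) :
    Tendsto (fun n : ℕ => (n.descFactorial m : ℝ) / (n : ℝ) ^ m) atTop (𝓝 1) := by
  have hlow : Tendsto (fun n : ℕ => (1 - ((m : ℝ) - 1) / n) ^ m) atTop (𝓝 1) := by
    have := (tendsto_const_div_atTop_nhds_zero_nat ((m : ℝ) - 1)).const_sub 1 |>.pow m
    simpa using this
  refine tendsto_of_tendsto_of_tendsto_of_le_of_le' hlow tendsto_const_nhds ?_ ?_
  · filter_upwards [eventually_ge_atTop (m + 1)] with n hn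
    have hn0 : (0 : ℝ) < n := by exact_mod_cast (by omega : 0 < n)
    have h := Nat.pow_sub_le_descFactorial n m
    have h2 : ((n : ℝ) + 1 - m) ^ m ≤ n.descFactorial m := by
      have e : ((n + 1 - m : ℕ) : ℝ) = (n : ℝ) + 1 - m := by
        rw [Nat.cast_sub (by omega)]; push_cast; ring
      rw [← e]; exact_mod_cast h
    rw [le_div_iff₀ (by positivity), ← mul_pow]
    refine le_of_eq_of_le ?_ h2
    congr 1
    field_simp
    ring
  · filter_upwards [eventually_ge_atTop 1] with n hn
    have hn0 : (0 : ℝ) < n := by exact_mod_cast hn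
    rw [div_le_one (by positivity)]
    exact_mod_cast Nat.descFactorial_le_pow n m

theorem measurePreserving_comp_of_injective {E ι κ : Type*} [MeasurableSpace E] [Fintype ι]
    [Fintype κ] (ν : Measure E) [IsProbabilityMeasure ν] {f : κ → ι} (hf : Function.Injective f) :
    MeasurePreserving (fun x : ι → E => x ∘ f) (Measure.pi fun _ => ν) (Measure.pi fun _ => ν) := by
  have h1 : iIndepFun (fun (i : ι) (x : ι → E) => x i) (Measure.pi fun _ => ν) :=
    iIndepFun_pi (X := fun _ => id) (fun _ => aemeasurable_id)
  have h2 := h1.precomp hf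
  have h3 := (iIndepFun_iff_map_fun_eq_pi_map
    (fun i => (measurable_pi_apply (f i)).aemeasurable)).1 h2
  refine ⟨measurable_pi_lambda _ fun i => measurable_pi_apply _, ?_⟩
  refine h3.trans ?_
  congr 1
  ext1 i
  exact (measurePreserving_eval (fun _ : ι => ν) (f i)).map_eq

section Averages

variable {E : Type*} [MeasurableSpace E]

/-- The average of `φ` over all samples of size `k`, with repetitions, from the points
`x 0, …, x (n - 1)`. -/
noncomputable def sampleAverage {k : ℕ} (φ : (Fin k → E) → ℝ) {n : ℕ} (x : Fin n → E) : ℝ :=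
  ((n : ℝ) ^ k)⁻¹ * ∑ f : Fin k → Fin n, φ (x ∘ f)

variable (ν : Measure E) [IsProbabilityMeasure ν] {k : ℕ} {φ : (Fin k → E) → ℝ}

/-- Two samples with disjoint indices and no repetition are independent. -/
theorem integral_mul_comp_eq_zero (hφ : Integrable φ (Measure.pi fun _ => ν)) {n : ℕ}
    {f g : Fin k → Fin n} (hfg : Function.Injective (Sum.elim f g)) :
    ∫ x : Fin n → E, (φ (x ∘ f) - ∫ y, φ y ∂Measure.pi fun _ => ν) *
      (φ (x ∘ g) - ∫ y, φ y ∂Measure.pi fun _ => ν) ∂(Measure.pi fun _ => ν) = 0 := by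
  set θ := ∫ y, φ y ∂Measure.pi fun _ => ν
  have h1 := measurePreserving_comp_of_injective ν hfg
  have h2 := measurePreserving_sumPiEquivProdPi (ι := Fin k) (ι' := Fin k) (fun _ => ν)
  have h3 := h2.comp h1
  have hcenter : ∫ y, (φ y - θ) ∂(Measure.pi fun _ => ν) = 0 := by
    rw [integral_sub hφ (integrable_const _)]; simp [θ]
  have h4 := integral_prod_mul (μ := Measure.pi fun _ : Fin k => ν)
    (ν := Measure.pi fun _ : Fin k => ν) (fun y => φ y - θ) (fun y => φ y - θ)
  rw [hcenter, zero_mul, ← h3.map_eq] at h4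
  have hint : AEStronglyMeasurable (fun z : (Fin k → E) × (Fin k → E) => (φ z.1 - θ) * (φ z.2 - θ))
      (Measure.map ((MeasurableEquiv.sumPiEquivProdPi fun _ => E) ∘
        fun x : Fin n → E => x ∘ Sum.elim f g) (Measure.pi fun _ => ν)) := by
    rw [h3.map_eq]
    have := hφ.sub (integrable_const θ)
    exact (this.mul_prod this).aestronglyMeasurable
  rw [integral_map h3.measurable.aemeasurable hint] at h4
  exact h4

/-- In the expansion of the square, only the pairs of maps `f`, `g` that share or repeat an index
contribute; the last factor is their proportion among all pairs. -/
theorem integral_sq_sampleAverage_sub_le (hφ : Measurable φ) {b : ℝ}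
    (hb : ∀ᵐ x ∂(Measure.pi fun _ => ν), 0 ≤ φ x ∧ φ x ≤ b) {n : ℕ} (hn : 0 < n)
    (hb' : ∀ᵐ x : Fin n → E ∂(Measure.pi fun _ => ν), ∀ f : Fin k → Fin n,
      0 ≤ φ (x ∘ f) ∧ φ (x ∘ f) ≤ b) :
    Integrable (fun x : Fin n → E => (sampleAverage φ x - ∫ y, φ y ∂Measure.pi fun _ => ν) ^ 2)
      (Measure.pi fun _ => ν) ∧
    ∫ x : Fin n → E, (sampleAverage φ x - ∫ y, φ y ∂Measure.pi fun _ => ν) ^ 2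
      ∂(Measure.pi fun _ => ν) ≤
        b ^ 2 * (1 - (n.descFactorial (k + k) : ℝ) / (n : ℝ) ^ (k + k)) := by
  classical
  have hφi : Integrable φ (Measure.pi fun _ => ν) :=
    Integrable.of_bound hφ.aestronglyMeasurable b (hb.mono fun x hx => by
      rw [Real.norm_eq_abs, abs_of_nonneg hx.1]; exact hx.2)
  set θ := ∫ y, φ y ∂Measure.pi fun _ => ν
  have hθ : 0 ≤ θ ∧ θ ≤ b := by
    refine ⟨integral_nonneg_of_ae (hb.mono fun x hx => hx.1), ?_⟩
    have := integral_mono_ae hφi (integrable_const b) (hb.mono fun x hx => hx.2)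
    simpa using this
  have hn0 : (0 : ℝ) < n := by exact_mod_cast hn
  have hexp : ∀ x : Fin n → E, (sampleAverage φ x - θ) ^ 2 = ((n : ℝ) ^ (k + k))⁻¹ *
      ∑ f : Fin k → Fin n, ∑ g : Fin k → Fin n, (φ (x ∘ f) - θ) * (φ (x ∘ g) - θ) := by
    intro x
    have h1 : sampleAverage φ x - θ = ((n : ℝ) ^ k)⁻¹ * ∑ f : Fin k → Fin n, (φ (x ∘ f) - θ) := by
      rw [Finset.sum_sub_distrib, mul_sub, sampleAverage]
      simp only [Finset.sum_const, Finset.card_univ, Fintype.card_fun, Fintype.card_fin,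
        nsmul_eq_mul]
      push_cast
      rw [← mul_assoc, inv_mul_cancel₀ (by positivity), one_mul]
    rw [h1, mul_pow, sq (∑ f : Fin k → Fin n, _), Finset.sum_mul_sum, inv_pow, ← pow_mul]
    congr 3
    ring
  have hmeas : ∀ f : Fin k → Fin n, Measurable fun x : Fin n → E => φ (x ∘ f) - θ := fun f =>
    (hφ.comp (measurable_pi_lambda _ fun i => measurable_pi_apply _)).sub_const _
  have habs : ∀ᵐ x : Fin n → E ∂(Measure.pi fun _ => ν), ∀ f g : Fin k → Fin n,
      |(φ (x ∘ f) - θ) * (φ (x ∘ g) - θ)| ≤ b ^ 2 := by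
    filter_upwards [hb'] with x hx f g
    have h : ∀ f, |φ (x ∘ f) - θ| ≤ b := fun f => by
      rw [abs_le]; constructor <;> linarith [(hx f).1, (hx f).2, hθ.1, hθ.2]
    rw [abs_mul, sq]
    exact mul_le_mul (h f) (h g) (abs_nonneg _) (hθ.1.trans hθ.2)
  have hti : ∀ f g : Fin k → Fin n, Integrable (fun x : Fin n → E =>
      (φ (x ∘ f) - θ) * (φ (x ∘ g) - θ)) (Measure.pi fun _ => ν) := fun f g =>
    Integrable.of_bound ((hmeas f).mul (hmeas g)).aestronglyMeasurable (b ^ 2)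
      (habs.mono fun x hx => hx f g)
  simp only [hexp]
  have hsi : ∀ f : Fin k → Fin n, Integrable (fun x : Fin n → E => ∑ g : Fin k → Fin n,
      (φ (x ∘ f) - θ) * (φ (x ∘ g) - θ)) (Measure.pi fun _ => ν) := fun f =>
    integrable_finsetSum _ fun g _ => hti f g
  refine ⟨(integrable_finsetSum _ fun f _ => hsi f).const_mul _, ?_⟩
  rw [integral_const_mul, integral_finsetSum _ fun f _ => hsi f]
  have hterm : ∀ f g : Fin k → Fin n, ∫ x : Fin n → E, (φ (x ∘ f) - θ) * (φ (x ∘ g) - θ)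
      ∂(Measure.pi fun _ => ν) ≤ if Function.Injective (Sum.elim f g) then 0 else b ^ 2 := by
    intro f g
    split_ifs with hfg
    · exact (integral_mul_comp_eq_zero ν hφi hfg).le
    · have := integral_mono_ae (hti f g) (integrable_const (b ^ 2))
        (habs.mono fun x hx => (le_abs_self _).trans (hx f g))
      simpa using this
  have hcount : ∑ f : Fin k → Fin n, ∑ g : Fin k → Fin n,
      (if Function.Injective (Sum.elim f g) then (0 : ℝ) else b ^ 2) =
      b ^ 2 * ((n : ℝ) ^ (k + k) - n.descFactorial (k + k)) := by
    have h1 : ∑ f : Fin k → Fin n, ∑ g : Fin k → Fin n,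
        (if Function.Injective (Sum.elim f g) then (0 : ℝ) else b ^ 2) =
        ∑ h : Fin k ⊕ Fin k → Fin n, (if Function.Injective h then (0 : ℝ) else b ^ 2) := by
      rw [← (Equiv.sumArrowEquivProdArrow (Fin k) (Fin k) (Fin n)).symm.sum_comp,
        Fintype.sum_prod_type]
      rfl
    have h2 : ∑ h : Fin k ⊕ Fin k → Fin n, (if Function.Injective h then (1 : ℝ) else 0) =
        n.descFactorial (k + k) := by
      rw [Finset.sum_boole, ← Fintype.card_subtype,
        Fintype.card_congr (Equiv.subtypeInjectiveEquivEmbedding (Fin k ⊕ Fin k) (Fin n)),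
        Fintype.card_embedding_eq]
      simp
    have h3 : ∀ h : Fin k ⊕ Fin k → Fin n, (if Function.Injective h then (0 : ℝ) else b ^ 2) =
        b ^ 2 * (1 - if Function.Injective h then (1 : ℝ) else 0) := fun h => by
      split_ifs <;> simp
    rw [h1]
    simp only [h3]
    rw [← Finset.mul_sum, Finset.sum_sub_distrib, h2]
    simp
  calc ((n : ℝ) ^ (k + k))⁻¹ * ∑ f : Fin k → Fin n, ∫ x : Fin n → E, ∑ g : Fin k → Fin n,
        (φ (x ∘ f) - θ) * (φ (x ∘ g) - θ) ∂(Measure.pi fun _ => ν)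
      ≤ ((n : ℝ) ^ (k + k))⁻¹ * (b ^ 2 * ((n : ℝ) ^ (k + k) - n.descFactorial (k + k))) := by
        rw [← hcount]
        gcongr with f
        rw [integral_finsetSum _ fun g _ => hti f g]
        exact Finset.sum_le_sum fun g _ => hterm f g
    _ = _ := by field_simp

end Averages

section Sampling

variable {d : ℕ} {L : EuclideanSpace ℝ (Fin d) → EuclideanSpace ℝ (Fin d) → ℂ}

theorem measurable_correlationDet (hL : Measurable (Function.uncurry L)) (k : ℕ) :
    Measurable (correlationDet L : (Fin k → EuclideanSpace ℝ (Fin d)) → ℝ) := by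
  unfold correlationDet
  refine Complex.measurable_re.comp ?_
  simp only [Matrix.det_apply, Matrix.of_apply]
  refine Finset.measurable_sum _ fun σ _ => Measurable.const_smul ?_ _
  refine Finset.measurable_prod _ fun i _ => ?_
  have h : Measurable fun x : Fin k → EuclideanSpace ℝ (Fin d) => (x (σ i), x i) :=
    (measurable_pi_apply (σ i)).prodMk (measurable_pi_apply i)
  exact hL.comp h

theorem correlationDet_eq_zero_of_not_injective {k : ℕ} {x : Fin k → EuclideanSpace ℝ (Fin d)}
    (hx : ¬ Function.Injective x) : correlationDet L x = 0 := by
  simp only [Function.Injective, not_forall] at hx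
  obtain ⟨i, j, hij, hne⟩ := hx
  rw [correlationDet, Matrix.det_zero_of_row_eq hne (by ext l; simp [hij])]
  simp

theorem isHermitian_of_kernel (hLh : ∀ x y, L x y = starRingEnd ℂ (L y x)) {ι : Type*}
    (x : ι → EuclideanSpace ℝ (Fin d)) :
    (Matrix.of fun i j => L (x i) (x j)).IsHermitian := by
  ext i j
  simp only [Matrix.conjTranspose_apply, Matrix.of_apply]
  exact (hLh _ _).symm

theorem minorSum_kernel {n : ℕ} (x : Fin n → EuclideanSpace ℝ (Fin d)) (k : ℕ) :
    minorSum (Matrix.of fun i j => L (x i) (x j)) k =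
      ∑ f : Fin k → Fin n, correlationDet L (x ∘ f) := rfl

theorem correlationDet_le_pow (hLh : ∀ x y, L x y = starRingEnd ℂ (L y x)) {T : ℝ} (hT : 0 < T)
    {n : ℕ} {x : Fin n → EuclideanSpace ℝ (Fin d)} (hd : ∀ i, L (x i) (x i) = T)
    (hx : ∀ (k : ℕ) (f : Fin k → Fin n), 0 ≤ correlationDet L (x ∘ f)) :
    correlationDet L x ≤ T ^ n := by
  have := det_re_le_of_diag (isHermitian_of_kernel hLh x) (fun k => by
    rw [minorSum_kernel]; exact Finset.sum_nonneg fun f _ => hx k f) hT hd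
  rwa [Fintype.card_fin] at this

variable (ν : Measure (EuclideanSpace ℝ (Fin d))) [IsProbabilityMeasure ν] {T : ℝ}

/-- Every submatrix of a random sample has a determinant in `[0, T ^ k]`: it is either sampled
without repetition, or has two equal rows. -/
theorem ae_correlationDet_bounds (hLh : ∀ x y, L x y = starRingEnd ℂ (L y x)) (hT : 0 < T)
    (hd : ∀ᵐ x ∂ν, L x x = T)
    (hpos : ∀ k : ℕ, ∀ᵐ x : Fin k → EuclideanSpace ℝ (Fin d) ∂(Measure.pi fun _ => ν),
      0 ≤ correlationDet L x) (n : ℕ) :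
    ∀ᵐ x : Fin n → EuclideanSpace ℝ (Fin d) ∂(Measure.pi fun _ => ν),
      (∀ i, L (x i) (x i) = T) ∧
      ∀ (k : ℕ) (f : Fin k → Fin n), 0 ≤ correlationDet L (x ∘ f) ∧
        correlationDet L (x ∘ f) ≤ T ^ k := by
  have h1 : ∀ᵐ x : Fin n → EuclideanSpace ℝ (Fin d) ∂(Measure.pi fun _ => ν),
      ∀ i, L (x i) (x i) = T := by
    rw [ae_all_iff]
    exact fun i => (measurePreserving_eval (fun _ => ν) i).quasiMeasurePreserving.ae hd
  have h2 : ∀ᵐ x : Fin n → EuclideanSpace ℝ (Fin d) ∂(Measure.pi fun _ => ν),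
      ∀ (k : ℕ) (f : Fin k → Fin n), 0 ≤ correlationDet L (x ∘ f) := by
    rw [ae_all_iff]; intro k
    rw [ae_all_iff]; intro f
    by_cases hf : Function.Injective f
    · exact (measurePreserving_comp_of_injective ν hf).quasiMeasurePreserving.ae (hpos k)
    · exact Filter.Eventually.of_forall fun x =>
        (correlationDet_eq_zero_of_not_injective fun h => hf h.of_comp).ge
  filter_upwards [h1, h2] with x hx1 hx2
  refine ⟨hx1, fun k f => ⟨hx2 k f, ?_⟩⟩
  exact correlationDet_le_pow hLh hT (fun i => hx1 (f i)) fun j g => hx2 j (f ∘ g)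

theorem ae_correlationDet_le (hLh : ∀ x y, L x y = starRingEnd ℂ (L y x)) (hT : 0 < T)
    (hd : ∀ᵐ x ∂ν, L x x = T)
    (hpos : ∀ k : ℕ, ∀ᵐ x : Fin k → EuclideanSpace ℝ (Fin d) ∂(Measure.pi fun _ => ν),
      0 ≤ correlationDet L x) (k : ℕ) :
    ∀ᵐ x : Fin k → EuclideanSpace ℝ (Fin d) ∂(Measure.pi fun _ => ν),
      0 ≤ correlationDet L x ∧ correlationDet L x ≤ T ^ k :=
  (ae_correlationDet_bounds ν hLh hT hd hpos k).mono fun _ hx => hx.2 k id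

open Filter Topology in
/-- The integrals `∫ det (L (x i) (x j)) dν^k` come from eigenvalues: for `n` independent points
with law `ν`, the eigenvalues of the matrix `L (x i) (x j) / n` have factorial moments
`n^{-k} ∑_f det (L (x (f i)) (x (f j)))`, and these averages converge in `L²`. -/
theorem isLimitOfEigenvalueMoments_integral (hLm : Measurable (Function.uncurry L))
    (hLh : ∀ x y, L x y = starRingEnd ℂ (L y x)) (hT : 0 < T)
    (hd : ∀ᵐ x ∂ν, L x x = T)
    (hpos : ∀ k : ℕ, ∀ᵐ x : Fin k → EuclideanSpace ℝ (Fin d) ∂(Measure.pi fun _ => ν),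
      0 ≤ correlationDet L x) :
    IsLimitOfEigenvalueMoments T
      (fun k => ∫ x : Fin k → EuclideanSpace ℝ (Fin d), correlationDet L x
        ∂(Measure.pi fun _ => ν)) := by
  intro N
  set M : ℕ → ℝ := fun k => ∫ x : Fin k → EuclideanSpace ℝ (Fin d), correlationDet L x
        ∂(Measure.pi fun _ => ν)
  have hbound := fun (k n : ℕ) (hn : 0 < n) => integral_sq_sampleAverage_sub_le ν
    (measurable_correlationDet hLm k) (ae_correlationDet_le ν hLh hT hd hpos k) hn
    ((ae_correlationDet_bounds ν hLh hT hd hpos n).mono fun x hx => hx.2 k)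
  have hlim : Tendsto (fun n : ℕ => ∑ k ∈ Finset.range (N + 1), (T ^ k) ^ 2 *
      (1 - (n.descFactorial (k + k) : ℝ) / (n : ℝ) ^ (k + k))) atTop (𝓝 0) := by
    have := tendsto_finsetSum (Finset.range (N + 1)) fun k _ =>
      ((tendsto_descFactorial_div_pow (k + k)).const_sub 1).const_mul ((T ^ k) ^ 2)
    simpa using this
  have hsmall : (0 : ℝ) < (1 / ((N : ℝ) + 1)) ^ 2 := by positivity
  -- A sample size for which the squared errors, summed over `k ≤ N`, are small in expectation.
  obtain ⟨n, hnlt, hn⟩ :=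
    ((hlim.eventually (gt_mem_nhds hsmall)).and (eventually_ge_atTop 1)).exists
  have hn' : 0 < n := hn
  have hn0 : (0 : ℝ) < n := by exact_mod_cast hn
  have hint := integrable_finsetSum (Finset.range (N + 1)) fun k _ => (hbound k n hn').1
  obtain ⟨x, hxgood, hx⟩ := exists_notMem_null_le_integral hint
    (ae_iff.1 (ae_correlationDet_bounds ν hLh hT hd hpos n))
  simp only [Set.mem_ofPred_eq, not_not] at hxgood
  obtain ⟨hxd, hxb⟩ := hxgood
  rw [integral_finsetSum _ fun k _ => (hbound k n hn').1] at hx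
  have hx2 : ∑ k ∈ Finset.range (N + 1), (sampleAverage (correlationDet L (k := k)) x - M k) ^ 2 ≤
      (1 / ((N : ℝ) + 1)) ^ 2 :=
    hx.trans ((Finset.sum_le_sum fun k _ => (hbound k n hn').2).trans hnlt.le)
  set A : Matrix (Fin n) (Fin n) ℂ :=
    Matrix.of fun i j => ((n : ℝ)⁻¹ : ℂ) * L (x i) (x j) with hAdef
  have hA : A.IsHermitian := by
    ext i j
    simp only [hAdef, Matrix.conjTranspose_apply, Matrix.of_apply]
    rw [hLh (x i) (x j)]
    simp
  have hminor : ∀ k, minorSum A k = sampleAverage (correlationDet L (k := k)) x := by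
    intro k
    rw [sampleAverage, minorSum, Finset.mul_sum]
    refine Finset.sum_congr rfl fun f _ => ?_
    have e : A.submatrix f f =
        ((n : ℝ)⁻¹ : ℂ) • Matrix.of fun i j => L ((x ∘ f) i) ((x ∘ f) j) := by
      ext i j; simp [hAdef]
    rw [e, Matrix.det_smul, correlationDet, Fintype.card_fin]
    have e2 : ((n : ℝ)⁻¹ : ℂ) ^ k = (((n : ℝ) ^ k)⁻¹ : ℝ) := by push_cast; simp
    rw [e2, Complex.re_ofReal_mul]
  have hmb : ∀ k, 0 ≤ minorSum A k ∧ minorSum A k ≤ T ^ k := by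
    intro k
    rw [hminor, sampleAverage]
    refine ⟨mul_nonneg (by positivity) (Finset.sum_nonneg fun f _ => (hxb k f).1), ?_⟩
    rw [inv_mul_le_iff₀ (by positivity)]
    refine (Finset.sum_le_sum fun f _ => (hxb k f).2).trans ?_
    simp
  have htr : ∑ i, hA.eigenvalues i = T := by
    rw [sum_eigenvalues_eq]
    simp only [Matrix.trace, Matrix.diag_apply, hAdef, Matrix.of_apply, hxd]
    simp [hn0.ne', -Complex.ofReal_natCast]
  refine ⟨n, hA.eigenvalues, minorSum A,
    eigenvalues_nonneg_of_minorSum_nonneg hA fun k => (hmb k).1, htr, ?_, hmb,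
    hasSum_minorSum hA, fun k hk => ?_⟩
  · rw [sum_sq_eigenvalues_eq, htr]
  · have h1 := (Finset.single_le_sum (f := fun k =>
      (sampleAverage (correlationDet L (k := k)) x - M k) ^ 2) (fun k _ => sq_nonneg _)
      (Finset.mem_range.2 (Nat.lt_succ_of_le hk))).trans hx2
    rw [hminor]
    exact abs_le_of_sq_le_sq h1 (by positivity)

end Sampling

/-! ### Factorial moments of a determinantal point process -/

section Counting

variable {ι : Type*}

/-- `k` points in distinct cells, the cell `c` containing `a c` points, viewed as `k` distinct
points. -/
def cellEmbedding (a : ι → ℕ) (k : ℕ) (z : Σ j : Fin k ↪ ι, ∀ i, Fin (a (j i))) :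
    Fin k ↪ Σ c, Fin (a c) :=
  ⟨fun i => ⟨z.1 i, z.2 i⟩, fun _ _ h => z.1.injective (congrArg Sigma.fst h)⟩

theorem cellEmbedding_injective (a : ι → ℕ) (k : ℕ) : Function.Injective (cellEmbedding a k) := by
  rintro ⟨j, u⟩ ⟨j', u'⟩ h
  have h1 : ∀ i, (⟨j i, u i⟩ : Σ c, Fin (a c)) = ⟨j' i, u' i⟩ := fun i =>
    congrArg (fun e : Fin k ↪ Σ c, Fin (a c) => e i) h
  obtain rfl : j = j' := by
    ext i; exact congrArg Sigma.fst (h1 i)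
  congr 1
  funext i
  simpa using h1 i

variable [Fintype ι]

theorem sum_embedding_prod_eq_card (a : ι → ℕ) (k : ℕ) :
    ∑ j : Fin k ↪ ι, ∏ i, a (j i) =
      Fintype.card (Σ j : Fin k ↪ ι, ∀ i, Fin (a (j i))) := by
  simp [Fintype.card_sigma]

/-- The left-hand side counts the `k`-tuples of points in distinct cells, the right-hand side all
`k`-tuples of distinct points. -/
theorem sum_embedding_prod_le (a : ι → ℕ) (k : ℕ) :
    ∑ j : Fin k ↪ ι, ∏ i, a (j i) ≤ (∑ c, a c).descFactorial k := by
  rw [sum_embedding_prod_eq_card]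
  refine (Fintype.card_le_of_injective _ (cellEmbedding_injective a k)).trans_eq ?_
  simp [Fintype.card_embedding_eq, Fintype.card_sigma]

theorem sum_embedding_prod_eq_of_le_one {a : ι → ℕ} (ha : ∀ c, a c ≤ 1) (k : ℕ) :
    ∑ j : Fin k ↪ ι, ∏ i, a (j i) = (∑ c, a c).descFactorial k := by
  rw [sum_embedding_prod_eq_card]
  have hsurj : Function.Surjective (cellEmbedding a k) := by
    intro e
    have hsub : ∀ c, Subsingleton (Fin (a c)) := fun c => by
      rw [Fin.subsingleton_iff_le_one]; exact ha c
    refine ⟨⟨⟨fun i => (e i).1, fun i i' h => e.injective ?_⟩, fun i => (e i).2⟩, ?_⟩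
    · have h' : (e i).1 = (e i').1 := h
      rcases hi : e i with ⟨c, u⟩
      rcases hi' : e i' with ⟨c', u'⟩
      rw [hi, hi'] at h'
      obtain rfl : c = c' := h'
      congr 1
      exact Subsingleton.elim _ _
    · ext i <;> rfl
  rw [Fintype.card_congr (Equiv.ofBijective _ ⟨cellEmbedding_injective a k, hsurj⟩)]
  simp [Fintype.card_embedding_eq, Fintype.card_sigma]

end Counting

section Cells

variable {α : Type*}

open Classical in
/-- The record of which of the first `n` sets of the sequence `S` contain a point. Its fibres form
a finite partition; the partitions are successively refined as `n` grows. -/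
noncomputable def cellCode (S : ℕ → Set α) (n : ℕ) (x : α) : Fin n → Bool :=
  fun i => decide (x ∈ S i)

theorem cellCode_eq_iff {S : ℕ → Set α} {n : ℕ} {x y : α} :
    cellCode S n x = cellCode S n y ↔ ∀ i < n, (x ∈ S i ↔ y ∈ S i) := by
  simp only [cellCode, funext_iff, decide_eq_decide]
  exact ⟨fun h i hi => h ⟨i, hi⟩, fun h i => h i i.2⟩

variable [MeasurableSpace α] {S : ℕ → Set α}

theorem measurable_cellCode (hS : ∀ n, MeasurableSet (S n)) (n : ℕ) :
    Measurable (cellCode S n) := by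
  refine measurable_pi_lambda _ fun i => ?_
  refine measurable_to_bool ?_
  convert hS i using 1
  ext x
  simp [cellCode]

theorem measurableSet_cell (hS : ∀ n, MeasurableSet (S n)) (n : ℕ) (c : Fin n → Bool) :
    MeasurableSet (cellCode S n ⁻¹' {c}) :=
  measurable_cellCode hS n (measurableSet_singleton c)

theorem sum_measure_cell (hS : ∀ n, MeasurableSet (S n)) (μ : Measure α) (n : ℕ) :
    ∑ c, μ (cellCode S n ⁻¹' {c}) = μ Set.univ := by
  rw [sum_measure_preimage_singleton _ fun c _ => measurableSet_cell hS n c]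
  simp

open Filter Topology in
/-- For a finite integer-valued measure without multiple points, fine enough cells contain at most
one point each: `∑ c, μ(c)²` is the `μ ⊗ μ`-measure of the pairs in a common cell, and it decreases
to the measure of the diagonal, which is at most the total mass `∑ c, μ(c)`. -/
theorem eventually_measure_cell_le_one (hS : ∀ n, MeasurableSet (S n))
    (hsep : ∀ x y, (∀ n, x ∈ S n ↔ y ∈ S n) → x = y) (μ : Measure α)
    (hμ : ∀ x, μ {x} ≤ 1) {m : ℕ} (hm : μ Set.univ = m) {a : (n : ℕ) → (Fin n → Bool) → ℕ}
    (ha : ∀ n c, μ (cellCode S n ⁻¹' {c}) = a n c) :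
    ∀ᶠ n in atTop, ∀ c, a n c ≤ 1 := by
  have hfin : IsFiniteMeasure μ := ⟨by rw [hm]; exact ENNReal.natCast_lt_top m⟩
  set G : ℕ → Set (α × α) := fun n => {q | cellCode S n q.1 = cellCode S n q.2} with hG
  have hGm : ∀ n, MeasurableSet (G n) := fun n =>
    measurableSet_eq_fun ((measurable_cellCode hS n).comp measurable_fst)
      ((measurable_cellCode hS n).comp measurable_snd)
  have hanti : Antitone G := fun n n' hn q hq => by
    simp only [hG, Set.mem_ofPred_eq, cellCode_eq_iff] at hq ⊢
    exact fun i hi => hq i (hi.trans_le hn)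
  have hdiag : ∀ x : α, Prod.mk x ⁻¹' (⋂ n, G n) = {x} := fun x => by
    ext y
    simp only [Set.mem_preimage, Set.mem_iInter, hG, Set.mem_ofPred_eq, cellCode_eq_iff,
      Set.mem_singleton_iff]
    refine ⟨fun h => (hsep _ _ fun n => h (n + 1) n n.lt_succ_self).symm, ?_⟩
    rintro rfl
    simp
  have hlim : μ.prod μ (⋂ n, G n) ≤ m := by
    rw [Measure.prod_apply (MeasurableSet.iInter hGm)]
    calc ∫⁻ x, μ (Prod.mk x ⁻¹' (⋂ n, G n)) ∂μ ≤ ∫⁻ _, 1 ∂μ :=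
          lintegral_mono fun x => by simp only [hdiag]; exact hμ x
      _ = m := by simp [hm]
  have htend := tendsto_measure_iInter_atTop (μ := μ.prod μ)
    (fun n => (hGm n).nullMeasurableSet) hanti ⟨0, measure_ne_top _ _⟩
  have hlt : μ.prod μ (⋂ n, G n) < ((m + 1 : ℕ) : ENNReal) :=
    hlim.trans_lt (by exact_mod_cast m.lt_succ_self)
  filter_upwards [htend.eventually (gt_mem_nhds hlt)] with n hn
  have hGn : μ.prod μ (G n) = ∑ c, ((a n c * a n c : ℕ) : ENNReal) := by
    have hU : G n = ⋃ c, (cellCode S n ⁻¹' {c}) ×ˢ (cellCode S n ⁻¹' {c}) := by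
      ext q
      simp [hG, eq_comm]
    rw [hU, measure_iUnion, tsum_fintype]
    · refine Finset.sum_congr rfl fun c _ => ?_
      rw [Measure.prod_prod, ha]; push_cast; rfl
    · intro c c' hcc
      refine Set.disjoint_left.2 fun q hq hq' => hcc ?_
      exact hq.1.symm.trans hq'.1
    · exact fun c => (measurableSet_cell hS n c).prod (measurableSet_cell hS n c)
  have hsum : ∑ c, a n c = m := by
    have := sum_measure_cell hS μ n
    simp only [ha, hm] at this
    exact_mod_cast this
  rw [Function.comp_apply, hGn] at hn
  have hn' : ∑ c, a n c * a n c < m + 1 := by exact_mod_cast hn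
  have hle : ∀ c ∈ Finset.univ, a n c ≤ a n c * a n c := fun c _ => Nat.le_mul_self _
  -- Both sums are integers and the second is less than `m + 1`.
  have heq : ∑ c, a n c = ∑ c, a n c * a n c :=
    le_antisymm (Finset.sum_le_sum hle) (by omega)
  intro c
  have := (Finset.sum_eq_sum_iff_of_le hle).1 heq c (Finset.mem_univ c)
  by_contra! h
  nlinarith

end Cells

section FactorialMoments

open Filter Topology

variable {Ω : Type*} [MeasurableSpace Ω] {d : ℕ} {X : Ω → Measure (EuclideanSpace ℝ (Fin d))}

/-- Integrality extends from bounded sets to sets of finite mass, as `ℕ` is closed in `ℝ`. -/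
theorem IsPointProcess.exists_eq_natCast (hX : IsPointProcess X) {ω : Ω}
    {A : Set (EuclideanSpace ℝ (Fin d))} (hA : MeasurableSet A) (hfin : X ω A ≠ ⊤) :
    ∃ n : ℕ, X ω A = n := by
  have hU : A = ⋃ n : ℕ, A ∩ Metric.ball 0 n := by
    rw [← Set.inter_iUnion, Metric.iUnion_ball_nat, Set.inter_univ]
  have hmono : Monotone fun n : ℕ => A ∩ Metric.ball (0 : EuclideanSpace ℝ (Fin d)) n :=
    fun n n' h => Set.inter_subset_inter_right _ (Metric.ball_subset_ball (by exact_mod_cast h))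
  have h1 := tendsto_measure_iUnion_atTop (μ := X ω) hmono
  rw [← hU] at h1
  have h2 := (ENNReal.tendsto_toReal hfin).comp h1
  have h3 : (X ω A).toReal ∈ Set.range ((↑) : ℕ → ℝ) := by
    refine Nat.isClosedEmbedding_coe_real.isClosed_range.mem_of_tendsto h2
      (Eventually.of_forall fun n => ?_)
    obtain ⟨m, hm⟩ := hX.integer_valued ω (A ∩ Metric.ball 0 n)
      (Metric.isBounded_ball.subset Set.inter_subset_right) (hA.inter measurableSet_ball)
    exact ⟨m, by simp [hm]⟩
  obtain ⟨m, hm⟩ := h3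
  refine ⟨m, ?_⟩
  rw [← ENNReal.ofReal_toReal hfin, ← hm, ENNReal.ofReal_natCast]

theorem IsPointProcess.measurable_eval (hX : IsPointProcess X)
    {A : Set (EuclideanSpace ℝ (Fin d))} (hA : MeasurableSet A) : Measurable fun ω => X ω A :=
  (Measure.measurable_coe hA).comp hX.measurable

/-- The factorial moments of the number of points. Tuples with equal entries, which lie in no
product of distinct cells, do not contribute on the right-hand side: their determinants vanish. -/
theorem lintegral_descFactorial_eq {P : Measure Ω}
    {K : EuclideanSpace ℝ (Fin d) → EuclideanSpace ℝ (Fin d) → ℂ}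
    (hX : IsDeterminantalWithKernel P X K) {B : Set (EuclideanSpace ℝ (Fin d))}
    (hB : MeasurableSet B) {N : Ω → ℕ} (hN : ∀ᵐ ω ∂P, X ω B = N ω) (k : ℕ) :
    ∫⁻ ω, ((N ω).descFactorial k : ENNReal) ∂P =
      ∫⁻ x in Set.univ.pi fun _ : Fin k => B, ENNReal.ofReal (correlationDet K x) := by
  obtain ⟨S, hS, hsep⟩ := exists_seq_separating (EuclideanSpace ℝ (Fin d))
    (p := MeasurableSet) MeasurableSet.empty Set.univ
  replace hsep : ∀ x y, (∀ n, x ∈ S n ↔ y ∈ S n) → x = y := fun x y =>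
    hsep x trivial y trivial
  set Q : (n : ℕ) → (Fin n → Bool) → Set (EuclideanSpace ℝ (Fin d)) := fun n c =>
    B ∩ cellCode S n ⁻¹' {c} with hQ
  have hQm : ∀ n c, MeasurableSet (Q n c) := fun n c => hB.inter (measurableSet_cell hS n c)
  have hQd : ∀ n c c', c ≠ c' → Disjoint (Q n c) (Q n c') := fun n c c' h =>
    Set.disjoint_left.2 fun x hx hx' => h (hx.2.symm.trans hx'.2)
  set F : ℕ → Ω → ENNReal := fun n ω => ∑ j : Fin k ↪ (Fin n → Bool), ∏ i, X ω (Q n (j i))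
  have hFm : ∀ n, Measurable (F n) := fun n =>
    Finset.measurable_sum _ fun j _ => Finset.measurable_prod _ fun i _ =>
      hX.isPointProcess.measurable_eval (hQm n _)
  -- The integral of `F n` is the integral of the determinant over tuples in distinct cells.
  set m : Measure (Fin k → EuclideanSpace ℝ (Fin d)) :=
    volume.withDensity fun x => ENNReal.ofReal (correlationDet K x) with hm
  set U : ℕ → Set (Fin k → EuclideanSpace ℝ (Fin d)) := fun n =>
    {x | (∀ i, x i ∈ B) ∧ Function.Injective fun i => cellCode S n (x i)} with hU
  have hFU : ∀ n, ∫⁻ ω, F n ω ∂P = m (U n) := by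
    intro n
    have h1 : U n = ⋃ j : Fin k ↪ (Fin n → Bool), Set.univ.pi fun i => Q n (j i) := by
      ext x
      simp only [hU, hQ, Set.mem_ofPred_eq, Set.mem_iUnion, Set.mem_pi, Set.mem_univ, true_imp_iff,
        Set.mem_inter_iff, Set.mem_preimage, Set.mem_singleton_iff]
      constructor
      · rintro ⟨hxB, hinj⟩
        exact ⟨⟨_, hinj⟩, fun i => ⟨hxB i, rfl⟩⟩
      · rintro ⟨j, hj⟩
        refine ⟨fun i => (hj i).1, fun i i' h => j.injective ?_⟩
        rw [← (hj i).2, ← (hj i').2]; exact h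
    have hmeas : ∀ j : Fin k ↪ (Fin n → Bool), MeasurableSet (Set.univ.pi fun i => Q n (j i)) :=
      fun j => MeasurableSet.univ_pi fun i => hQm n _
    rw [h1, measure_iUnion _ hmeas, tsum_fintype, lintegral_finsetSum]
    · refine Finset.sum_congr rfl fun j _ => ?_
      rw [hX.joint_intensity k (fun i => Q n (j i)) (fun i => hQm n _)
        (fun i i' h => hQd n _ _ (j.injective.ne h)), hm, withDensity_apply _ (hmeas j)]
    · exact fun j _ => Finset.measurable_prod _ fun i _ =>
        hX.isPointProcess.measurable_eval (hQm n _)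
    · intro j j' hjj
      refine Set.disjoint_left.2 fun x hx hx' => hjj ?_
      ext i : 1
      exact (hx i trivial).2.symm.trans (hx' i trivial).2
  have hUlim : Tendsto (fun n => ∫⁻ ω, F n ω ∂P) atTop
      (𝓝 (∫⁻ x in Set.univ.pi fun _ : Fin k => B, ENNReal.ofReal (correlationDet K x))) := by
    simp only [hFU]
    have hmono : Monotone U := fun n n' hn x hx => by
      refine ⟨hx.1, fun i i' h => hx.2 ?_⟩
      simp only [cellCode_eq_iff] at h ⊢
      exact fun l hl => h l (hl.trans_le hn)
    have hae : (⋃ n, U n : Set (Fin k → EuclideanSpace ℝ (Fin d))) =ᵐ[m]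
        Set.univ.pi fun _ : Fin k => B := by
      have hinj : ∀ᵐ x ∂m, Function.Injective x := by
        rw [hm, ae_withDensity_iff
          (measurable_correlationDet hX.measurable_kernel k).ennreal_ofReal]
        refine ae_of_all _ fun x hx => ?_
        by_contra h
        exact hx (by rw [correlationDet_eq_zero_of_not_injective h, ENNReal.ofReal_zero])
      filter_upwards [hinj] with x hx
      refine propext ?_
      change x ∈ (⋃ n, U n) ↔ x ∈ Set.univ.pi fun _ : Fin k => B
      simp only [Set.mem_iUnion, Set.mem_pi, Set.mem_univ, true_imp_iff, hU, Set.mem_ofPred_eq]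
      refine ⟨fun ⟨n, hn⟩ => hn.1, fun hxB => ?_⟩
      have hev : ∀ i i', i ≠ i' → ∀ᶠ n in atTop, cellCode S n (x i) ≠ cellCode S n (x i') := by
        intro i i' h
        have h1 : ¬ ∀ n, x i ∈ S n ↔ x i' ∈ S n := fun hc => hx.ne h (hsep _ _ hc)
        push Not at h1
        obtain ⟨n₀, hn₀⟩ := h1
        filter_upwards [eventually_gt_atTop n₀] with n hn hc
        rw [cellCode_eq_iff] at hc
        have := hc n₀ hn
        tauto
      have hall : ∀ᶠ n in atTop, ∀ i i', i ≠ i' → cellCode S n (x i) ≠ cellCode S n (x i') := by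
        simp only [eventually_all]
        exact hev
      obtain ⟨n, hn⟩ := hall.exists
      exact ⟨n, hxB, fun i i' h => by
        by_contra hne; exact hn i i' hne h⟩
    have := tendsto_measure_iUnion_atTop (μ := m) hmono
    rw [measure_congr hae, hm, withDensity_apply _ (MeasurableSet.univ_pi fun _ => hB)] at this
    exact this
  -- Pointwise, `F n` is at most the factorial power and eventually equal to it.
  have hpt : ∀ᵐ ω ∂P, (∀ n, F n ω ≤ (N ω).descFactorial k) ∧
      ∀ᶠ n in atTop, F n ω = (N ω).descFactorial k := by
    filter_upwards [hN, hX.simple] with ω hω hsimple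
    have hex : ∀ n c, ∃ q : ℕ, X ω (Q n c) = q := fun n c => by
      refine hX.isPointProcess.exists_eq_natCast (hQm n c) (ne_top_of_le_ne_top ?_
        (measure_mono Set.inter_subset_left))
      rw [hω]; exact ENNReal.natCast_ne_top _
    choose a ha using hex
    have hres : ∀ n c, (X ω).restrict B (cellCode S n ⁻¹' {c}) = a n c := fun n c => by
      rw [Measure.restrict_apply (measurableSet_cell hS n c), Set.inter_comm]; exact ha n c
    have hsum : ∀ n, ∑ c, a n c = N ω := fun n => by
      have := sum_measure_cell hS ((X ω).restrict B) n
      simp only [hres, Measure.restrict_apply_univ, hω] at this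
      exact_mod_cast this
    have hF : ∀ n, F n ω = ((∑ j : Fin k ↪ (Fin n → Bool), ∏ i, a n (j i) : ℕ) : ENNReal) :=
      fun n => by simp [F, ha]
    refine ⟨fun n => ?_, ?_⟩
    · rw [hF, ← hsum n]
      exact_mod_cast sum_embedding_prod_le (a n) k
    · filter_upwards [eventually_measure_cell_le_one hS hsep ((X ω).restrict B)
        (fun x => (Measure.restrict_apply_le _ _).trans (hsimple x))
        (by rw [Measure.restrict_apply_univ, hω]) hres] with n hn
      rw [hF, ← hsum n, sum_embedding_prod_eq_of_le_one hn]
  refine le_antisymm ?_ ?_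
  · calc ∫⁻ ω, ((N ω).descFactorial k : ENNReal) ∂P
        ≤ ∫⁻ ω, liminf (fun n => F n ω) atTop ∂P := by
          refine lintegral_mono_ae (hpt.mono fun ω hω => ?_)
          exact (Tendsto.liminf_eq (tendsto_const_nhds.congr'
            (hω.2.mono fun n hn => hn.symm))).ge
      _ ≤ liminf (fun n => ∫⁻ ω, F n ω ∂P) atTop := lintegral_liminf_le hFm
      _ = _ := hUlim.liminf_eq
  · exact le_of_tendsto' hUlim fun n => lintegral_mono_ae (hpt.mono fun ω hω => hω.1 n)

end FactorialMoments

/-! ### Normalization of the kernel and the moment inequality -/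

section Density

theorem pi_withDensity_ofReal {E ι : Type*} [MeasurableSpace E] [Fintype ι] (μ : Measure E)
    [SigmaFinite μ] {w : E → ℝ} (hw0 : ∀ x, 0 ≤ w x) (hw : Integrable w μ) :
    Measure.pi (fun _ : ι => μ.withDensity fun x => ENNReal.ofReal (w x)) =
      (Measure.pi fun _ : ι => μ).withDensity fun x => ∏ i, ENNReal.ofReal (w (x i)) := by
  have hfin : IsFiniteMeasure (μ.withDensity fun x => ENNReal.ofReal (w x)) :=
    isFiniteMeasure_withDensity_ofReal hw.2
  refine (Measure.pi_eq fun s hs => ?_)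
  have hind : ∀ i, Integrable ((s i).indicator w) μ := fun i => hw.indicator (hs i)
  rw [withDensity_apply _ (MeasurableSet.univ_pi hs),
    ← lintegral_indicator (MeasurableSet.univ_pi hs)]
  have h1 : ∀ x : ι → E, (Set.univ.pi s).indicator (fun x => ∏ i, ENNReal.ofReal (w (x i))) x =
      ENNReal.ofReal (∏ i, (s i).indicator w (x i)) := by
    intro x
    rw [ENNReal.ofReal_prod_of_nonneg fun i _ => Set.indicator_nonneg (fun y _ => hw0 y) _]
    by_cases hx : x ∈ Set.univ.pi s
    · rw [Set.indicator_of_mem hx]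
      exact Finset.prod_congr rfl fun i _ => by rw [Set.indicator_of_mem (hx i trivial)]
    · rw [Set.indicator_of_notMem hx]
      simp only [Set.mem_pi, Set.mem_univ, true_imp_iff, not_forall] at hx
      obtain ⟨i, hi⟩ := hx
      exact (Finset.prod_eq_zero (Finset.mem_univ i) (by simp [hi])).symm
  simp only [h1]
  rw [← ofReal_integral_eq_lintegral_ofReal (Integrable.fintype_prod hind)
    (ae_of_all _ fun x => Finset.prod_nonneg fun i _ => Set.indicator_nonneg (fun y _ => hw0 y) _),
    integral_fintype_prod_eq_prod, ENNReal.ofReal_prod_of_nonneg fun i _ =>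
      integral_nonneg fun y => Set.indicator_nonneg (fun y _ => hw0 y) _]
  refine Finset.prod_congr rfl fun i _ => ?_
  rw [integral_indicator (hs i), withDensity_apply _ (hs i),
    ofReal_integral_eq_lintegral_ofReal hw.integrableOn (ae_of_all _ hw0)]

end Density

section Kernel

variable {Ω : Type*} [MeasurableSpace Ω] {d : ℕ} {P : Measure Ω}
  {X : Ω → Measure (EuclideanSpace ℝ (Fin d))}
  {K : EuclideanSpace ℝ (Fin d) → EuclideanSpace ℝ (Fin d) → ℂ}

theorem ae_comp_of_injective {k n : ℕ} {f : Fin k → Fin n} (hf : Function.Injective f)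
    {s : Set (Fin k → EuclideanSpace ℝ (Fin d))} (hs : MeasurableSet s) (h : ∀ᵐ x, x ∈ s) :
    ∀ᵐ x : Fin n → EuclideanSpace ℝ (Fin d), x ∘ f ∈ s :=
  (ae_comp_linearMap_mem_iff (LinearMap.funLeft ℝ (EuclideanSpace ℝ (Fin d)) f) volume volume
    (LinearMap.funLeft_surjective_of_injective ℝ _ f hf) hs).2 h

theorem kernel_self_eq (hK : ∀ x y, K x y = starRingEnd ℂ (K y x)) (x) :
    K x x = ((K x x).re : ℂ) := (Complex.conj_eq_iff_real.1 (hK x x).symm).elim fun r hr => by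
  rw [hr]; simp

/-- Minors of order two force `K x y = 0` wherever `K x x` vanishes. -/
theorem ae_correlationDet_eq_zero (hX : IsDeterminantalWithKernel P X K) (k : ℕ) :
    ∀ᵐ x : Fin k → EuclideanSpace ℝ (Fin d), (∃ i, (K (x i) (x i)).re = 0) →
      correlationDet K x = 0 := by
  have hset : ∀ m, MeasurableSet {x : Fin m → EuclideanSpace ℝ (Fin d) | 0 ≤ correlationDet K x} :=
    fun m => measurableSet_le measurable_const (measurable_correlationDet hX.measurable_kernel m)
  have h2 : ∀ᵐ x : Fin k → EuclideanSpace ℝ (Fin d), ∀ i j : Fin k, i ≠ j →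
      0 ≤ correlationDet K (x ∘ ![i, j]) := by
    simp only [ae_all_iff]
    intro i j hij
    refine ae_comp_of_injective (f := ![i, j]) ?_ (hset 2) (hX.correlationDet_nonneg 2)
    intro a b hab
    fin_cases a <;> fin_cases b <;> simp_all [eq_comm]
  filter_upwards [h2] with x hx
  rintro ⟨i, hi⟩
  have hrow : ∀ j, K (x i) (x j) = 0 := by
    intro j
    by_cases hij : i = j
    · rw [← hij, kernel_self_eq hX.hermitian, hi]; simp
    have h := hx i j hij
    simp only [correlationDet, Matrix.det_fin_two, Matrix.of_apply, Function.comp_apply,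
      Matrix.cons_val_zero, Matrix.cons_val_one] at h
    rw [kernel_self_eq hX.hermitian (x i), hi, hX.hermitian (x j) (x i), Complex.mul_conj] at h
    simp only [Complex.ofReal_zero, zero_mul, zero_sub, Complex.neg_re, Complex.ofReal_re] at h
    exact Complex.normSq_eq_zero.1 (le_antisymm (by linarith) (Complex.normSq_nonneg _))
  rw [correlationDet, Matrix.det_eq_zero_of_row_eq_zero i hrow]
  simp

theorem ae_kernel_self_nonneg (hX : IsDeterminantalWithKernel P X K) :
    ∀ᵐ x, 0 ≤ (K x x).re := by
  have h := hX.correlationDet_nonneg 1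
  have hp := (volume_preserving_funUnique (Fin 1) (EuclideanSpace ℝ (Fin d))).symm
  have := hp.quasiMeasurePreserving.ae h
  filter_upwards [this] with x hx
  simpa [correlationDet] using hx

theorem lintegral_eq_setLIntegral_kernel_self (hX : IsDeterminantalWithKernel P X K)
    {B : Set (EuclideanSpace ℝ (Fin d))} (hB : MeasurableSet B) :
    ∫⁻ ω, X ω B ∂P = ∫⁻ x in B, ENNReal.ofReal (K x x).re := by
  have h := hX.joint_intensity 1 (fun _ => B) (fun _ => hB) (fun i j hij =>
    (hij (Subsingleton.elim i j)).elim)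
  have hp := (volume_preserving_funUnique (Fin 1) (EuclideanSpace ℝ (Fin d)))
  rw [← hp.setLIntegral_comp_preimage_emb (MeasurableEquiv.measurableEmbedding _)]
  simp only [Finset.univ_unique, Finset.prod_singleton] at h
  rw [h]
  congr 1
  · congr 1
    ext x
    simp [Fin.forall_fin_one]
  · ext x
    simp [correlationDet]

/-- The kernel with respect to the probability density `w`: dividing `K x y` by `√(w x w y)` turns
the correlation densities with respect to Lebesgue measure into those with respect to `w dx`. -/
noncomputable def normalizedKernel
    (K : EuclideanSpace ℝ (Fin d) → EuclideanSpace ℝ (Fin d) → ℂ)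
    (w : EuclideanSpace ℝ (Fin d) → ℝ) (x y : EuclideanSpace ℝ (Fin d)) : ℂ :=
  ((Real.sqrt (w x))⁻¹ : ℝ) * (K x y * ((Real.sqrt (w y))⁻¹ : ℝ))

theorem correlationDet_normalizedKernel (w : EuclideanSpace ℝ (Fin d) → ℝ) (hw : ∀ x, 0 ≤ w x)
    {k : ℕ} (x : Fin k → EuclideanSpace ℝ (Fin d)) :
    correlationDet (normalizedKernel K w) x = (∏ i, w (x i))⁻¹ * correlationDet K x := by
  have h1 : (Matrix.of fun i j => normalizedKernel K w (x i) (x j)) =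
      Matrix.of fun i j => (((Real.sqrt (w (x i)))⁻¹ : ℝ) : ℂ) * (Matrix.of fun i j =>
        (((Real.sqrt (w (x j)))⁻¹ : ℝ) : ℂ) * (Matrix.of fun i j => K (x i) (x j)) i j) i j := by
    ext i j; simp only [Matrix.of_apply, normalizedKernel]; ring
  rw [correlationDet, h1, Matrix.det_mul_column, Matrix.det_mul_row, ← mul_assoc,
    ← Complex.ofReal_prod, ← Complex.ofReal_mul, Complex.re_ofReal_mul, ← correlationDet]
  congr 1
  rw [← Finset.prod_mul_distrib, ← Finset.prod_inv_distrib]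
  refine Finset.prod_congr rfl fun i _ => ?_
  rw [← mul_inv, Real.mul_self_sqrt (hw _)]

/-- The factorial moments of the number of points in `B` are limits of elementary symmetric
functions of eigenvalues. -/
theorem IsDeterminantalWithKernel.exists_factorialMoments
    (hX : IsDeterminantalWithKernel P X K) {B : Set (EuclideanSpace ℝ (Fin d))}
    (hB : MeasurableSet B) {N : Ω → ℕ}
    (hN : ∀ᵐ ω ∂P, X ω B = N ω) {T : ℝ} (hT : 0 < T)
    (hBT : ∫⁻ ω, X ω B ∂P = ENNReal.ofReal T) :
    ∃ M : ℕ → ℝ, (∀ k, ∫⁻ ω, ((N ω).descFactorial k : ENNReal) ∂P = ENNReal.ofReal (M k)) ∧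
      (∀ k, 0 ≤ M k ∧ M k ≤ T ^ k) ∧ IsLimitOfEigenvalueMoments T M := by
  set w : EuclideanSpace ℝ (Fin d) → ℝ := fun x => max (K x x).re 0 / T with hw
  have hw0 : ∀ x, 0 ≤ w x := fun x => div_nonneg (le_max_right _ _) hT.le
  have hKm : Measurable fun x => (K x x).re :=
    Complex.measurable_re.comp (hX.measurable_kernel.comp (measurable_id.prodMk measurable_id))
  have hwm : Measurable w := (hKm.max measurable_const).div_const T
  have hofw : ∀ x, ENNReal.ofReal (w x) = ENNReal.ofReal (K x x).re / ENNReal.ofReal T :=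
      fun x => by
    rw [hw, ENNReal.ofReal_div_of_pos hT]
    congr 1
    rcases le_total (K x x).re 0 with h | h
    · rw [max_eq_right h, ENNReal.ofReal_of_nonpos h, ENNReal.ofReal_zero]
    · rw [max_eq_left h]
  have hmass : ∫⁻ x in B, ENNReal.ofReal (w x) = 1 := by
    simp only [hofw, div_eq_mul_inv]
    rw [lintegral_mul_const _ hKm.ennreal_ofReal, ← lintegral_eq_setLIntegral_kernel_self hX hB,
      hBT, ENNReal.mul_inv_cancel (by simpa using hT) ENNReal.ofReal_ne_top]
  have hwi : Integrable w (volume.restrict B) := by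
    refine ⟨hwm.aestronglyMeasurable, ?_⟩
    rw [hasFiniteIntegral_iff_ofReal (ae_of_all _ hw0), hmass]
    exact ENNReal.one_lt_top
  set ν : Measure (EuclideanSpace ℝ (Fin d)) :=
    (volume.restrict B).withDensity fun x => ENNReal.ofReal (w x) with hν
  have hνp : IsProbabilityMeasure ν := ⟨by rw [hν, withDensity_apply _ .univ]; simpa using hmass⟩
  have hpi : ∀ k, Measure.pi (fun _ : Fin k => ν) =
      (volume.restrict (Set.univ.pi fun _ : Fin k => B)).withDensity
        fun x => ∏ i, ENNReal.ofReal (w (x i)) := fun k => by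
    rw [hν, pi_withDensity_ofReal _ hw0 hwi, volume_pi, Measure.restrict_pi_pi]
  set L := normalizedKernel K w with hL
  have hLm : Measurable (Function.uncurry L) := by
    have h1 : Measurable fun x => (((Real.sqrt (w x))⁻¹ : ℝ) : ℂ) :=
      Complex.measurable_ofReal.comp hwm.sqrt.inv
    exact (h1.comp measurable_fst).mul (hX.measurable_kernel.mul (h1.comp measurable_snd))
  have hLh : ∀ x y, L x y = starRingEnd ℂ (L y x) := fun x y => by
    simp only [hL, normalizedKernel, map_mul, Complex.conj_ofReal]
    rw [hX.hermitian x y]; ring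
  have hd' : ∀ᵐ x ∂ν, L x x = T := by
    have h1 : ∀ᵐ x ∂ν, ENNReal.ofReal (w x) ≠ 0 := by
      rw [hν, ae_withDensity_iff hwm.ennreal_ofReal]
      exact ae_of_all _ fun x hx => hx
    filter_upwards [h1] with x hx
    have hwx : 0 < w x := by simpa using hx
    have hK : 0 < (K x x).re := by
      by_contra! h
      simp [hw, max_eq_right h] at hwx
    have e : L x x = (((w x)⁻¹ * (K x x).re : ℝ) : ℂ) := by
      rw [hL, normalizedKernel, kernel_self_eq hX.hermitian x]
      norm_cast
      nth_rewrite 3 [← Real.mul_self_sqrt hwx.le]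
      rw [mul_inv]; ring
    rw [e]
    norm_cast
    simp only [hw, max_eq_left hK.le]
    field_simp
  have hpos : ∀ k : ℕ, ∀ᵐ x : Fin k → EuclideanSpace ℝ (Fin d) ∂(Measure.pi fun _ => ν),
      0 ≤ correlationDet L x := by
    intro k
    rw [hpi]
    refine (withDensity_absolutelyContinuous _ _).ae_le (ae_restrict_of_ae ?_)
    filter_upwards [hX.correlationDet_nonneg k] with x hx
    rw [hL, correlationDet_normalizedKernel w hw0]
    exact mul_nonneg (inv_nonneg.2 (Finset.prod_nonneg fun i _ => hw0 _)) hx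
  have hbd := ae_correlationDet_le ν hLh hT hd' hpos
  have hint : ∀ k, Integrable (correlationDet L)
      (Measure.pi fun _ : Fin k => ν) := fun k =>
    Integrable.of_bound (measurable_correlationDet hLm k).aestronglyMeasurable (T ^ k)
      ((hbd k).mono fun x hx => by rw [Real.norm_eq_abs, abs_of_nonneg hx.1]; exact hx.2)
  refine ⟨fun k => ∫ x : Fin k → EuclideanSpace ℝ (Fin d), correlationDet L x
    ∂(Measure.pi fun _ => ν), fun k => ?_, fun k => ⟨?_, ?_⟩,
    isLimitOfEigenvalueMoments_integral ν hLm hLh hT hd' hpos⟩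
  · have hprod : Measurable fun x : Fin k → EuclideanSpace ℝ (Fin d) =>
        ∏ i, ENNReal.ofReal (w (x i)) := Finset.measurable_prod _ fun i _ =>
      (hwm.comp (measurable_pi_apply i)).ennreal_ofReal
    rw [lintegral_descFactorial_eq hX hB hN,
      ofReal_integral_eq_lintegral_ofReal (hint k) (hpos k), hpi,
      lintegral_withDensity_eq_lintegral_mul _ hprod
        (measurable_correlationDet hLm k).ennreal_ofReal]
    refine lintegral_congr_ae (ae_restrict_of_ae ?_)
    have hself : ∀ᵐ x : Fin k → EuclideanSpace ℝ (Fin d), ∀ i, 0 ≤ (K (x i) (x i)).re := by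
      rw [ae_all_iff]
      exact fun i => (Measure.quasiMeasurePreserving_eval (fun _ : Fin k =>
        (volume : Measure (EuclideanSpace ℝ (Fin d)))) i).ae (ae_kernel_self_nonneg hX)
    filter_upwards [ae_correlationDet_eq_zero hX k, hself] with x hx0 hxs
    simp only [Pi.mul_apply]
    rw [hL, correlationDet_normalizedKernel w hw0,
      ← ENNReal.ofReal_prod_of_nonneg fun i _ => hw0 _,
      ← ENNReal.ofReal_mul (Finset.prod_nonneg fun i _ => hw0 _), ← mul_assoc]
    -- Where the density vanishes, the kernel `L` is zero by the convention for `0⁻¹`, and so is the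
    -- determinant of `K`.
    by_cases h : ∃ i, (K (x i) (x i)).re = 0
    · rw [hx0 h]; simp
    · push Not at h
      rw [mul_inv_cancel₀, one_mul]
      refine Finset.prod_ne_zero_iff.2 fun i _ => ?_
      simp only [hw, max_eq_left (hxs i)]
      exact div_ne_zero (h i) hT.ne'
  · exact integral_nonneg_of_ae (hpos k)
  · have := integral_mono_ae (hint k) (integrable_const (T ^ k)) ((hbd k).mono fun x hx => hx.2)
    simpa using this

end Kernel

section Main

variable {Ω : Type*} [MeasurableSpace Ω] {d : ℕ} {P : Measure Ω} [IsProbabilityMeasure P]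

theorem isLimitOfEigenvalueMoments_zero :
    IsLimitOfEigenvalueMoments 0 (fun k => (0 : ℝ) ^ k) := fun n =>
  ⟨0, fun _ => 0, fun k => 0 ^ k, fun _ => le_rfl, by simp, by simp,
    fun k => ⟨by positivity, le_rfl⟩, fun z => by
      convert hasSum_ite_eq (0 : ℕ) (1 : ℝ) using 2 with k
      · rcases k with _ | k <;> simp
      · simp, fun k _ => by simpa using by positivity⟩

/-- The moment generating function of the number of points of a Hermitian determinantal process in
a set is bounded like that of a sum of independent Bernoulli variables. -/
theorem memLp_and_integral_exp_pointCount_le {X : Ω → Measure (EuclideanSpace ℝ (Fin d))}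
    (hX : IsHermitianDPP P X) {B : Set (EuclideanSpace ℝ (Fin d))} (hB : MeasurableSet B)
    (hfin : ∫⁻ ω, X ω B ∂P < ⊤) :
    (∀ q : NNReal, MemLp (pointCount X B) q P) ∧ ∀ s : ℝ, |s| ≤ 1 →
      Integrable (fun ω => Real.exp (s * pointCount X B ω)) P ∧
      ∫ ω, Real.exp (s * pointCount X B ω) ∂P ≤
        Real.exp (s * (∫ ω, pointCount X B ω ∂P) + s ^ 2 * variance (pointCount X B) P) := by
  obtain ⟨K, hK⟩ := hX
  have hXm : Measurable fun ω => X ω B := hK.isPointProcess.measurable_eval hB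
  set N : Ω → ℕ := fun ω => ⌊pointCount X B ω⌋₊ with hNdef
  have hNm : Measurable N := Nat.measurable_floor.comp hXm.ennreal_toReal
  have hN : ∀ᵐ ω ∂P, X ω B = N ω := by
    filter_upwards [ae_lt_top hXm hfin.ne] with ω hω
    obtain ⟨n, hn⟩ := hK.isPointProcess.exists_eq_natCast hB hω.ne
    simp [hNdef, pointCount, hn]
  have hY : pointCount X B =ᵐ[P] fun ω => (N ω : ℝ) := by
    filter_upwards [hN] with ω hω
    rw [pointCount, hω, ENNReal.toReal_natCast]
  set T : ℝ := (∫⁻ ω, X ω B ∂P).toReal with hTdef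
  have hT0 : 0 ≤ T := ENNReal.toReal_nonneg
  have hBT : ∫⁻ ω, X ω B ∂P = ENNReal.ofReal T := (ENNReal.ofReal_toReal hfin.ne).symm
  have hNT : ∫⁻ ω, (N ω : ENNReal) ∂P = ENNReal.ofReal T := by
    rw [← hBT]; exact lintegral_congr_ae (hN.mono fun ω hω => hω.symm)
  obtain ⟨M, hMI, hMb, hlim⟩ : ∃ M : ℕ → ℝ,
      (∀ k, ∫⁻ ω, ((N ω).descFactorial k : ENNReal) ∂P = ENNReal.ofReal (M k)) ∧
      (∀ k, 0 ≤ M k ∧ M k ≤ T ^ k) ∧ IsLimitOfEigenvalueMoments T M := by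
    -- If `T = 0`, there is no probability density `K x x / T`.
    rcases hT0.eq_or_lt with hT | hT
    · have hNe : Measurable fun ω => (N ω : ENNReal) :=
        (measurable_from_nat (f := fun n : ℕ => (n : ENNReal))).comp hNm
      rw [← hT, ENNReal.ofReal_zero, lintegral_eq_zero_iff hNe] at hNT
      refine ⟨fun k => 0 ^ k, fun k => ?_, fun k => ⟨by positivity, by rw [hT]⟩,
        hT ▸ isLimitOfEigenvalueMoments_zero⟩
      have h0 : ∀ᵐ ω ∂P, ((N ω).descFactorial k : ENNReal) = ENNReal.ofReal (0 ^ k) := by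
        filter_upwards [hNT] with ω hω
        have : N ω = 0 := by simpa using hω
        rcases k with _ | k <;> simp [this]
      rw [lintegral_congr_ae h0]
      simp
    · exact hK.exists_factorialMoments hB hN hT hBT
  have hcast : ∀ k ω,
      ENNReal.ofReal ((N ω).descFactorial k : ℝ) = ((N ω).descFactorial k : ENNReal) :=
    fun k ω => ENNReal.ofReal_natCast _
  have hi : ∀ k, Integrable (fun ω => ((N ω).descFactorial k : ℝ)) P := fun k => by
    refine ⟨(measurable_from_nat (f := fun n => (n.descFactorial k : ℝ))).comp hNm
      |>.aestronglyMeasurable, ?_⟩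
    rw [hasFiniteIntegral_iff_ofReal (ae_of_all _ fun ω => by positivity)]
    simp only [hcast, hMI]
    exact ENNReal.ofReal_lt_top
  have hI : ∀ k, ∫ ω, ((N ω).descFactorial k : ℝ) ∂P = M k := fun k => by
    rw [integral_eq_lintegral_of_nonneg_ae (ae_of_all _ fun ω => by positivity) (hi k).1]
    simp only [hcast, hMI]
    exact ENNReal.toReal_ofReal (hMb k).1
  have hM1 : M 1 = T := by
    have h := hMI 1
    simp only [Nat.descFactorial_one] at h
    rw [hNT] at h
    exact ((ENNReal.ofReal_eq_ofReal_iff hT0 (hMb 1).1).1 h).symm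
  have hexp := fun (s : ℝ) (hs : |s| ≤ 1) =>
    integrable_exp_and_le_of_factorialMoments hNm hi hI hMb hlim hs
  have hexpY : ∀ s : ℝ, (fun ω => Real.exp (s * pointCount X B ω)) =ᵐ[P]
      fun ω => Real.exp (s * N ω) := fun s => hY.mono fun ω hω => by simp only [hω]
  have hmem : ∀ q : NNReal, MemLp (pointCount X B) q P := fun q => by
    refine memLp_of_mem_interior_integrableExpSet ?_ q
    refine mem_interior.2 ⟨Set.Ioo (-1) 1, fun s hs => ?_, isOpen_Ioo, by norm_num⟩
    exact (hexp s (abs_le.2 ⟨hs.1.le, hs.2.le⟩)).1.congr (hexpY s).symm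
  have hmean : ∫ ω, pointCount X B ω ∂P = T := by
    rw [integral_congr_ae hY, ← hM1, ← hI 1]; simp
  have hvar : variance (pointCount X B) P = T - (T ^ 2 - M 2) := by
    rw [variance_eq_sub (by simpa using hmem 2), hmean]
    have h2 : ∫ ω, (pointCount X B ^ 2) ω ∂P = M 2 + M 1 := by
      rw [← hI 2, ← hI 1, ← integral_add (hi 2) (hi 1)]
      refine integral_congr_ae (hY.mono fun ω hω => ?_)
      simp only [Pi.pow_apply, hω]
      rcases hn : N ω with _ | n
      · simp
      · simp [Nat.descFactorial_succ]; ring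
    rw [h2, hM1]; ring
  refine ⟨hmem, fun s hs => ?_⟩
  rw [hmean, hvar, integral_congr_ae (hexpY s)]
  exact ⟨(hexp s hs).1.congr (hexpY s).symm, (hexp s hs).2⟩

theorem IsPlaneSquare.isCompact {B : Set (EuclideanSpace ℝ (Fin 2))} (hB : IsPlaneSquare B) :
    IsCompact B := by
  obtain ⟨s, -, f, rfl⟩ := hB
  refine IsCompact.image ?_ f.continuous
  have h : IsCompact (Set.univ.pi fun _ : Fin 2 => Set.Icc (0 : ℝ) s) :=
    isCompact_univ_pi fun _ => isCompact_Icc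
  have h2 := h.image (EuclideanSpace.equiv (Fin 2) ℝ).symm.continuous
  have heq : {x : EuclideanSpace ℝ (Fin 2) | ∀ i, 0 ≤ x i ∧ x i ≤ s} =
      (EuclideanSpace.equiv (Fin 2) ℝ).symm '' Set.univ.pi fun _ : Fin 2 => Set.Icc (0 : ℝ) s := by
    ext x
    rw [Set.mem_image]
    exact ⟨fun h => ⟨EuclideanSpace.equiv (Fin 2) ℝ x, fun i _ => h i, by simp⟩, by
      rintro ⟨y, hy, rfl⟩ i; exact hy i trivial⟩
  rw [heq]
  exact h2

end Main

theorem centralMoment_pointCount_le {Ω : Type*} [MeasurableSpace Ω] {P : Measure Ω}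
    [IsProbabilityMeasure P] {d : ℕ} {X : Ω → Measure (EuclideanSpace ℝ (Fin d))}
    (hX : IsHermitianDPP P X) {B : Set (EuclideanSpace ℝ (Fin d))} (hB : MeasurableSet B)
    (hfin : ∫⁻ ω, X ω B ∂P < ⊤) {p : ℝ} (hp : 0 ≤ p) :
    ∫ ω, |pointCount X B ω - ∫ ω', pointCount X B ω' ∂P| ^ p ∂P
      ≤ centralMomentConst p * (variance (pointCount X B) P ^ (p / 2) + 1) :=
  integral_abs_sub_rpow_le (variance_nonneg _ _) hp
    (memLp_and_integral_exp_pointCount_le hX hB hfin).2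

theorem proposition4 :
    (∀ p : ℝ, 1 ≤ p → ∃ γ : ℝ, 0 < γ ∧
      ∀ (d : ℕ) (Ω : Type u) [MeasurableSpace Ω] (P : Measure Ω) [IsProbabilityMeasure P]
        (X : Ω → Measure (EuclideanSpace ℝ (Fin d))), IsHermitianDPP P X →
      ∀ B : Set (EuclideanSpace ℝ (Fin d)), MeasurableSet B → ∫⁻ ω, X ω B ∂P < ⊤ →
        MemLp (pointCount X B) 2 P ∧ MemLp (pointCount X B) (ENNReal.ofReal p) P ∧
        ∫ ω, |pointCount X B ω - ∫ ω', pointCount X B ω' ∂P| ^ p ∂P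
          ≤ γ * (variance (pointCount X B) P ^ (p / 2) + 1)) ∧
    (∀ (Ω : Type u) [MeasurableSpace Ω] (P : Measure Ω) [IsProbabilityMeasure P]
        (X : Ω → Measure (EuclideanSpace ℝ (Fin 2))), IsHermitianDPP P X →
      ∀ ε : ℝ, 0 < ε → ε < 1 → SquareMomentHypothesis P X 2 ε →
        ∀ p : ℝ, 1 ≤ p → SquareMomentHypothesis P X p ε) := by
  refine ⟨fun p hp => ⟨centralMomentConst p, centralMomentConst_pos p, ?_⟩, ?_⟩
  · intro d Ω _ P _ X hX B hB hfin
    have hmem := (memLp_and_integral_exp_pointCount_le hX hB hfin).1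
    exact ⟨by simpa using hmem 2, hmem p.toNNReal,
      centralMoment_pointCount_le hX hB hfin (by linarith)⟩
  · intro Ω _ P _ X hX ε hε hε1 hH p hp
    obtain ⟨γ, hγ, hH⟩ := hH
    -- The summand `1` is absorbed because the area is at least `1`.
    refine ⟨centralMomentConst p * (γ ^ (p / 2) + 1),
      mul_pos (centralMomentConst_pos p) (by positivity), fun B hBs hB1 => ?_⟩
    obtain ⟨h2, hle⟩ := hH B hBs hB1
    have hBm : MeasurableSet B := hBs.isCompact.isClosed.measurableSet
    have hvol : volume B ≠ ⊤ := hBs.isCompact.measure_lt_top.ne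
    set A := (volume B).toReal with hA
    have hA1 : 1 ≤ A := by
      rw [hA, ← ENNReal.toReal_one]; exact ENNReal.toReal_mono hvol hB1
    have hfin : ∫⁻ ω, X ω B ∂P < ⊤ := by
      obtain ⟨K, hK⟩ := hX
      have hint : Integrable (pointCount X B) P := h2.integrable (by simp)
      have h := hint.lintegral_lt_top
      refine lt_of_eq_of_lt (lintegral_congr fun ω => ?_) h
      obtain ⟨n, hn⟩ := hK.isPointProcess.integer_valued ω B hBs.isCompact.isBounded hBm
      rw [pointCount, hn]; simp
    have hmem := (memLp_and_integral_exp_pointCount_le hX hBm hfin).1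
    refine ⟨hmem p.toNNReal,
      (centralMoment_pointCount_le hX hBm hfin (by linarith)).trans ?_⟩
    have hvar : variance (pointCount X B) P ≤ γ * A ^ (1 - ε) := by
      rw [variance_eq_integral (by simpa using (hmem 2).aestronglyMeasurable.aemeasurable)]
      simpa using hle
    have hE : (A ^ (1 - ε)) ^ (p / 2) = A ^ ((1 - ε) * p / 2) := by
      rw [← Real.rpow_mul (by linarith)]; ring_nf
    have hone : 1 ≤ A ^ ((1 - ε) * p / 2) := Real.one_le_rpow hA1 (by
      have : 0 ≤ (1 - ε) * p := mul_nonneg (by linarith) (by linarith)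
      linarith)
    have hvp : variance (pointCount X B) P ^ (p / 2) ≤ γ ^ (p / 2) * A ^ ((1 - ε) * p / 2) := by
      rw [← hE, ← Real.mul_rpow hγ.le (by positivity)]
      exact Real.rpow_le_rpow (variance_nonneg _ _) hvar (by linarith)
    rw [mul_assoc]
    refine mul_le_mul_of_nonneg_left ?_ (centralMomentConst_pos p).le
    rw [add_mul, one_mul]
    exact add_le_add hvp hone
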